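/- Let $G$ be a finite connected graph (loops and multiple edges allowed) that remains connected after the removal of any one edge, and fix an orientation of $G$. Let $\mathcal F(G)\subset\mathbb Z^{E(G)}$ be its lattice of integer flows, with the inner product $(\cdot,\cdot)$ induced by the Euclidean one, let $r$ be its rank, and let $A$ be the Gram matrix of $\mathcal F(G)$ in some lattice basis. Let $V(G)$ be the Voronoi cell of $\mathcal F(G)$ in $\mathcal F(G)\otimes\mathbb R$, that is, the set of points at least as close to $0$ as to every other lattice point. For a lattice vector $v$ let $F_v=\{x\in V(G): (x,v)=(v,v)/2\}$. The circuit element of an oriented circuit is the signed sum of its edges. The graphic matroid $\mathcal M(G)$ is given by the ground set $E(G)$ and the family of (edge sets of) circuits of $G$, equivalently by the $(0,1)$-matrix with rows indexed by circuits and columns by edges that records which edge participates in which circuit. A 2-cut is a pair of distinct edges whose removal disconnects $G$; the 2-cut blocks are the classes of the equivalence relation "$e=f$ or $\{e,f\}$ is a 2-cut" on $E(G)$. Then $\mathcal M(G)$ can be computed from $\mathcal F(G)$: there is a partial recursive function, independent of $G$, which is defined at every such Gram matrix $A$ and whose value there is the $(0,1)$-matrix of $\mathcal M(G)$ (for some ordering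 of rows and columns). Moreover, $\mathcal M(G)$ is obtained from $A$ by the following explicit procedure. 1. $V(G)$ has finitely many facets (faces of codimension one). Each facet equals $F_v$ for exactly one lattice vector $v$, and $F_v$ is a facet if and only if $v$ is a circuit element. Call a lattice basis $C_1,\dots,C_r$ good if every $F_{C_i}$ is a facet and, for all $i\ne j$, $F_{C_i}$ meets $F_{C_j}$ or $F_{-C_j}$. Good bases exist, and every good basis is a cancellation-free circuit basis: its members are circuit elements, and the number of common edges of the circuits $C_i$ and $C_j$ is $|(C_i,C_j)|$ for all $i,j$. 2. $V(G)$ has finitely many edges $\epsilon$ (one-dimensional faces). Let $[\epsilon]$ denote their parallel classes, and write $[\epsilon]\in F$ if some edge in the class $[\epsilon]$ is contained in the facet $F$, and $[\epsilon]\notin F$ otherwise. There is a bijection $[\epsilon]\mapsto S_{[\epsilon]}$ from the parallel classes onto the 2-cut blocks of $G$, with the following properties for every good basis $C_1,\dots,C_r$. 3. The system of linear equations $$\sum_{[\epsilon]\notin F_{C_i}} n_{[\epsilon]}=(C_i,C_i)\quad(1\le i\le r),\qquad \sum_{[\epsilon]\notin F_{C_i},\,[\epsilon]\notin F_{C_j}}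 n_{[\epsilon]}=|(C_i,C_j)|\quad(i\ne j)$$ has a unique solution $\{n_{[\epsilon]}\}$ in positive integers. 4. This solution is $n_{[\epsilon]}=|S_{[\epsilon]}|$, and $E(G)$ is the disjoint union of the sets $S_{[\epsilon]}$. So $E(G)$ can be identified with the disjoint union of sets of sizes $n_{[\epsilon]}$, one for each parallel class, in such a way that $S_{[\epsilon]}$ corresponds to the set of $[\epsilon]$. 5. Under this identification, an edge $e\in S_{[\epsilon]}$ belongs to the circuit with circuit element $C$ if and only if $[\epsilon]\notin F_C$. The circuits of $G$ are exactly the sets $\bigcup_{[\epsilon]\notin F}S_{[\epsilon]}$, where $F$ runs over the facets of $V(G)$. -/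

import Mathlib

open scoped Graph Matrix

namespace FlowRecon

section Graphs

variable {α β : Type*}

/-! ### Multigraphs: connectedness, 2-cuts, circuits

Graphs are Mathlib's multigraphs `Graph α β` (loops and parallel edges allowed). -/

/-- A graph is connected if it has a vertex and any two vertices are joined by a walk. -/
def Connected (G : Graph α β) : Prop :=
  V(G).Nonempty ∧ ∀ x ∈ V(G), ∀ y ∈ V(G), Relation.ReflTransGen G.Adj x y

/-- A connected graph that remains connected after the removal of any one edge. -/
def TwoEdgeConnected (G : Graph α β) : Prop :=
  Connected G ∧ ∀ e ∈ E(G), Connected (G.deleteEdges {e})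

/-- Two distinct edges form a 2-cut if the graph is disconnected by the removal of both. -/
def IsTwoCut (G : Graph α β) (e f : E(G)) : Prop :=
  e ≠ f ∧ ¬ Connected (G.deleteEdges {e.1, f.1})

/-- The 2-cut blocks: the classes of the equivalence relation
"`e` and `f` are the same or form a 2-cut". -/
def IsTwoCutBlock (G : Graph α β) (B : Set E(G)) : Prop :=
  ∃ e, B = {f | e = f ∨ IsTwoCut G e f}

/-- The closed walk `v 0, e 0, v 1, e 1, …, v k, e k, v 0` (indices modulo `k + 1`)
is a walk of `G` and repeats no vertex and no edge. -/
def IsSimpleClosedWalk (G : Graph α β) (k : ℕ) (v : Fin (k + 1) → α)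
    (e : Fin (k + 1) → E(G)) : Prop :=
  v.Injective ∧ e.Injective ∧ ∀ i, G.IsLink (e i).1 (v i) (v (i + 1))

/-- The (unoriented) circuits of `G`, as edge sets. The graphic matroid of `G` is given by
the ground set `E(G)` and this family of circuits. -/
def IsCircuit (G : Graph α β) (C : Set E(G)) : Prop :=
  ∃ k v e, IsSimpleClosedWalk G k v e ∧ C = Set.range e

open Classical in
/-- The rows of `X` form the `(0,1)`-matrix of the graphic matroid of `G`: for suitable
enumerations of the edges and of the circuits of `G`, the columns are indexed by the edges and
the rows by the circuits, with an entry `1` exactly when the edge participates in the circuit. -/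
def IsMatroidMatrix (G : Graph α β) (X : List (List Bool)) : Prop :=
  ∃ (m : ℕ) (edge : Fin m ≃ E(G)) (circuit : Fin X.length ≃ {C : Set E(G) // IsCircuit G C}),
    ∀ i, X.get i = List.ofFn fun j => decide (edge j ∈ (circuit i).1)

/-! ### Orientations and the lattice of integer flows -/

/-- An orientation of `G`: a direction for each edge. -/
structure Orientation (G : Graph α β) where
  /-- The vertex at which the edge starts. -/
  tail : E(G) → α
  /-- The vertex at which the edge ends. -/
  head : E(G) → α
  isLink : ∀ e : E(G), G.IsLink e.1 (tail e) (head e)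

variable {G : Graph α β} [Fintype E(G)]

open Classical in
/-- The lattice of integer flows: at each vertex the incoming and the outgoing sums agree. -/
noncomputable def flowLattice (o : Orientation G) : Submodule ℤ (E(G) → ℤ) where
  carrier := {a | ∀ x ∈ V(G), ∑ e with o.head e = x, a e - ∑ e with o.tail e = x, a e = 0}
  zero_mem' := by intro x _; simp
  add_mem' := by
    intro a b ha hb x hx
    have h1 := ha x hx
    have h2 := hb x hx
    simp only [Pi.add_apply, Finset.sum_add_distrib]
    linarith
  smul_mem' := by
    intro c a ha x hx
    have h1 := ha x hx
    simp only [Pi.smul_apply, smul_eq_mul, ← Finset.mul_sum, ← mul_sub]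
    rw [h1, mul_zero]

/-- The inner product induced by the Euclidean one on `ℤ^E(G)`. -/
def pairing (a b : E(G) → ℤ) : ℤ := ∑ e, a e * b e

open Classical in
/-- Circuit elements: the signed edge sums of oriented circuits, with coefficient `1` on the
edges traversed from tail to head and `-1` on those traversed backwards. -/
def IsCircuitElement (o : Orientation G) (a : E(G) → ℤ) : Prop :=
  ∃ k v e, IsSimpleClosedWalk G k v e ∧ ∃ s : Fin (k + 1) → ℤ,
    (∀ i, (s i = 1 ∧ o.tail (e i) = v i ∧ o.head (e i) = v (i + 1)) ∨
      (s i = -1 ∧ o.head (e i) = v i ∧ o.tail (e i) = v (i + 1))) ∧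
    a = ∑ i, Pi.single (e i) (s i)

/-- The edges used by a flow. -/
def edgeSupport (a : E(G) → ℤ) : Set E(G) := {e | a e ≠ 0}

/-- The flow with coordinates `v` in the basis `b`. -/
noncomputable def flowOf {o : Orientation G} {r : ℕ} (b : Module.Basis (Fin r) ℤ (flowLattice o))
    (v : Fin r → ℤ) : E(G) → ℤ :=
  ((∑ i, v i • b i : flowLattice o) : E(G) → ℤ)

/-- The Gram matrix of the lattice of integer flows in the basis `b`. -/
noncomputable def gramMatrix {o : Orientation G} {r : ℕ}
    (b : Module.Basis (Fin r) ℤ (flowLattice o)) : Matrix (Fin r) (Fin r) ℤ :=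
  fun i j => pairing (b i : E(G) → ℤ) (b j : E(G) → ℤ)

/-- A family of circuit elements in which the number of common edges of any two members is the
absolute value of their pairing. -/
def IsCancellationFree {r : ℕ} (o : Orientation G) (C : Fin r → (E(G) → ℤ)) : Prop :=
  (∀ i, IsCircuitElement o (C i)) ∧
    ∀ i j, ((edgeSupport (C i) ∩ edgeSupport (C j)).ncard : ℤ) = |pairing (C i) (C j)|

end Graphs

/-! ### The procedure

Everything below depends only on an integer matrix `A`, the Gram matrix of a lattice. The
lattice is `Fin r → ℤ` and the ambient space is `Fin r → ℝ`, both with the form given by `A`. -/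

section Procedure

variable {r : ℕ}

/-- The inner product of lattice vectors. -/
def latticeForm (A : Matrix (Fin r) (Fin r) ℤ) (u w : Fin r → ℤ) : ℤ := u ⬝ᵥ (A *ᵥ w)

/-- The inner product on the real span of the lattice. -/
def realForm (A : Matrix (Fin r) (Fin r) ℤ) (x y : Fin r → ℝ) : ℝ :=
  x ⬝ᵥ (A.map (fun a : ℤ => (a : ℝ)) *ᵥ y)

/-- A lattice vector as a point of the real span. -/
def toReal (v : Fin r → ℤ) : Fin r → ℝ := fun i => (v i : ℝ)

/-- The Voronoi cell: the points at least as close to the origin as to any lattice point. -/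
def voronoiCell (A : Matrix (Fin r) (Fin r) ℤ) : Set (Fin r → ℝ) :=
  {x | ∀ v : Fin r → ℤ, realForm A x x ≤ realForm A (x - toReal v) (x - toReal v)}

/-- The nonempty faces of the Voronoi cell (the cell itself included). -/
def IsFace (A : Matrix (Fin r) (Fin r) ℤ) (F : Set (Fin r → ℝ)) : Prop :=
  F.Nonempty ∧ IsExposed ℝ (voronoiCell A) F

/-- The faces of codimension one. -/
def IsFacet (A : Matrix (Fin r) (Fin r) ℤ) (F : Set (Fin r → ℝ)) : Prop :=
  IsFace A F ∧ Module.finrank ℝ (vectorSpan ℝ F) + 1 = r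

/-- The edges of the Voronoi cell: its faces of dimension one. -/
def VoronoiEdge (A : Matrix (Fin r) (Fin r) ℤ) : Type :=
  {F : Set (Fin r → ℝ) // IsFace A F ∧ Module.finrank ℝ (vectorSpan ℝ F) = 1}

/-- Parallelism of edges of the Voronoi cell. -/
def parallel (A : Matrix (Fin r) (Fin r) ℤ) : Setoid (VoronoiEdge A) where
  r ε ε' := vectorSpan ℝ ε.1 = vectorSpan ℝ ε'.1
  iseqv := ⟨fun _ => rfl, fun h => h.symm, fun h h' => h.trans h'⟩

/-- The parallel classes of edges of the Voronoi cell. -/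
def EdgeClass (A : Matrix (Fin r) (Fin r) ℤ) : Type := Quotient (parallel A)

/-- Some edge of the parallel class `c` belongs to the face `F`. -/
def Participates {A : Matrix (Fin r) (Fin r) ℤ} (c : EdgeClass A) (F : Set (Fin r → ℝ)) : Prop :=
  ∃ ε : VoronoiEdge A, Quotient.mk (parallel A) ε = c ∧ ε.1 ⊆ F

/-- The part of the Voronoi cell on the perpendicular bisector of the lattice vector `v`. -/
def bisectorFace (A : Matrix (Fin r) (Fin r) ℤ) (v : Fin r → ℤ) : Set (Fin r → ℝ) :=
  {x ∈ voronoiCell A | realForm A x (toReal v) = realForm A (toReal v) (toReal v) / 2}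

/-- A good basis, read off from the facets: a lattice basis of vectors whose perpendicular
bisectors support facets, such that for any two of them, `C i` and `C j`, the facet of `C i`
meets the facet of `C j` or the facet of `-C j`. -/
structure IsGoodBasis (A : Matrix (Fin r) (Fin r) ℤ) (C : Fin r → (Fin r → ℤ)) : Prop where
  linearIndependent : LinearIndependent ℤ C
  span_eq_top : Submodule.span ℤ (Set.range C) = ⊤
  isFacet : ∀ i, IsFacet A (bisectorFace A (C i))
  meets : ∀ i j, i ≠ j →
    (bisectorFace A (C i) ∩ bisectorFace A (C j)).Nonempty ∨
      (bisectorFace A (C i) ∩ bisectorFace A (-C j)).Nonempty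

/-- The positive integer solutions of the linear system of the basis `C`, with one unknown for
each parallel class of edges and one equation for each basis vector and each pair of them. -/
structure IsSolution (A : Matrix (Fin r) (Fin r) ℤ) (C : Fin r → (Fin r → ℤ))
    (n : EdgeClass A → ℕ) : Prop where
  pos : ∀ c, 0 < n c
  length : ∀ i, ((∑ᶠ c ∈ {c : EdgeClass A | ¬ Participates c (bisectorFace A (C i))}, n c : ℕ) : ℤ)
    = latticeForm A (C i) (C i)
  intersect : ∀ i j, i ≠ j →
    ((∑ᶠ c ∈ {c : EdgeClass A | ¬ Participates c (bisectorFace A (C i)) ∧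
        ¬ Participates c (bisectorFace A (C j))}, n c : ℕ) : ℤ)
      = |latticeForm A (C i) (C j)|

/-- The ground set put out by the procedure: a disjoint union of sets of sizes `n c`. -/
abbrev GroundSet (A : Matrix (Fin r) (Fin r) ℤ) (n : EdgeClass A → ℕ) : Type :=
  Σ c : EdgeClass A, Fin (n c)

/-- The circuits put out by the procedure: for each facet, the elements whose parallel class
does not participate in it. -/
def IsOutputCircuit (A : Matrix (Fin r) (Fin r) ℤ) (n : EdgeClass A → ℕ)
    (X : Set (GroundSet A n)) : Prop :=
  ∃ F, IsFacet A F ∧ X = {p | ¬ Participates p.1 F}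

end Procedure

end FlowRecon

open FlowRecon

/-!
Let `B` be the matrix whose rows are the basis flows, so that the Gram matrix is `B * Bᵀ` and a
vector `z` of the real span has the edge coordinates `z ᵥ* B`. The flow lattice is regular: every
nonzero `z` conforms to a sum of flows with entries in `{-1, 0, 1}`. By regularity the maximum of a
linear form over the Voronoi cell is attained on a face that depends only on the signs of the edge
coordinates of its direction, as for the zonotope spanned by the orthogonal projections of the unit
vectors of `ℝ^E`. Hence the facets belong to the flows of minimal support, the edge directions are
the projections of the unit vectors, and two of these are parallel exactly if the corresponding
edges are equal or form a 2-cut.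

The sizes of the 2-cut blocks solve the linear system because pairings of a good basis have no
cancellation. They are the only solution because the absolute values of pairwise non-proportional
linear forms are linearly independent. The same independence shows that the Gram matrix determines
`B` up to signs and a permutation of its columns, among all matrices whose row lattice has a
`{-1, 0, 1}`-vector in each class modulo `2`. This property is decidable, so an unbounded search
finds such a matrix, and the circuits are the minimal nonempty supports modulo `2`.
-/

namespace FlowRecon

section Coordinates

variable {E : Type*} {r : ℕ} {B : Matrix (Fin r) E ℤ}

/-- The coordinates, indexed by the columns of `B`, of a real combination of the rows of `B`. -/
noncomputable def coord (B : Matrix (Fin r) E ℤ) : (Fin r → ℝ) →ₗ[ℝ] (E → ℝ) :=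
  Matrix.vecMulLinear (B.map (Int.cast : ℤ → ℝ))

lemma coord_apply (z : Fin r → ℝ) (e : E) : coord B z e = ∑ i, z i * (B i e : ℝ) := rfl

lemma coord_toReal (v : Fin r → ℤ) (e : E) : coord B (toReal v) e = ((v ᵥ* B) e : ℝ) := by
  simp [coord_apply, toReal, Matrix.vecMul, dotProduct]

lemma toReal_injective : Function.Injective (toReal : (Fin r → ℤ) → (Fin r → ℝ)) :=
  fun _ _ h => funext fun i => Int.cast_injective (congrFun h i)

@[simp] lemma toReal_zero : toReal (0 : Fin r → ℤ) = 0 := by ext; simp [toReal]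

lemma toReal_ne_zero {v : Fin r → ℤ} (hv : v ≠ 0) : toReal v ≠ 0 :=
  toReal_zero (r := r) ▸ toReal_injective.ne hv

/-- A lattice vector with coordinates in `{-1, 0, 1}`. -/
def IsSignVector (B : Matrix (Fin r) E ℤ) (u : Fin r → ℤ) : Prop := ∀ e, |(u ᵥ* B) e| ≤ 1

/-- `z` has the sign of `v` in every coordinate in which `v` is nonzero. -/
def Conforms (B : Matrix (Fin r) E ℤ) (v z : Fin r → ℝ) : Prop :=
  ∀ e, coord B v e ≠ 0 → 0 < coord B v e * coord B z e

/-- There is no coordinate in which `v` and `z` have opposite signs. -/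
def SignAgree (B : Matrix (Fin r) E ℤ) (v z : Fin r → ℝ) : Prop :=
  ∀ e, 0 ≤ coord B v e * coord B z e

/-- The rows of `B` are linearly independent and span a regular lattice without zero coordinates:
every nonzero vector of the real span dominates a nonzero lattice vector with entries in
`{-1, 0, 1}`. -/
structure IsRegular (B : Matrix (Fin r) E ℤ) : Prop where
  inj : ∀ z, coord B z = 0 → z = 0
  conformal : ∀ z, z ≠ 0 → ∃ u, u ≠ 0 ∧ IsSignVector B u ∧ Conforms B (toReal u) z
  col_ne : ∀ e, ∃ i, B i e ≠ 0

/-- The vectors whose coordinates vanish wherever those of `z` do. -/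
def supportSpace (B : Matrix (Fin r) E ℤ) (z : Fin r → ℝ) : Submodule ℝ (Fin r → ℝ) where
  carrier := {y | ∀ e, coord B z e = 0 → coord B y e = 0}
  zero_mem' _ _ := by simp
  add_mem' ha hb e he := by simp [ha e he, hb e he]
  smul_mem' _ _ ha e he := by simp [ha e he]

lemma mem_supportSpace {z y : Fin r → ℝ} :
    y ∈ supportSpace B z ↔ ∀ e, coord B z e = 0 → coord B y e = 0 := Iff.rfl

lemma mem_supportSpace_self (z : Fin r → ℝ) : z ∈ supportSpace B z := fun _ he => he

lemma supportSpace_le {z y : Fin r → ℝ} (hy : y ∈ supportSpace B z) :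
    supportSpace B y ≤ supportSpace B z := fun _ hx e he => hx e (hy e he)

lemma Conforms.mem_supportSpace {v z : Fin r → ℝ} (h : Conforms B v z) :
    v ∈ supportSpace B z := by
  intro e he
  by_contra hne
  simpa [he] using h e hne

lemma Conforms.signAgree {v z : Fin r → ℝ} (h : Conforms B v z) : SignAgree B v z := by
  intro e
  by_cases he : coord B v e = 0
  · simp [he]
  · exact (h e he).le

lemma SignAgree.symm {u v : Fin r → ℝ} (h : SignAgree B u v) : SignAgree B v u :=
  fun e => mul_comm (coord B u e) _ ▸ h e

lemma IsRegular.exists_coord_ne_zero (h : IsRegular B) {z : Fin r → ℝ} (hz : z ≠ 0) :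
    ∃ e, coord B z e ≠ 0 := by
  by_contra! hcon
  exact hz (h.inj z (funext hcon))

lemma mul_sub_mul_nonneg {a b t : ℝ} (h : 0 ≤ b * a) (hle : t * |b| ≤ |a|) :
    0 ≤ b * (a - t * b) :=
  calc (0 : ℝ) ≤ |b| * (|a| - t * |b|) := mul_nonneg (abs_nonneg b) (sub_nonneg.mpr hle)
    _ = |b * a| - t * (|b| * |b|) := by rw [abs_mul]; ring
    _ = b * (a - t * b) := by rw [abs_of_nonneg h, abs_mul_abs_self]; ring

lemma SignAgree.sub_smul {v z : Fin r → ℝ} {t : ℝ} (h : SignAgree B v z)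
    (hle : ∀ e, t * |coord B v e| ≤ |coord B z e|) : SignAgree B v (z - t • v) := by
  intro e
  simpa using mul_sub_mul_nonneg (h e) (hle e)

lemma SignAgree.abs_coord_add_smul {v z : Fin r → ℝ} (h : SignAgree B v z) {t : ℝ} (ht : 0 ≤ t)
    (e : E) : |coord B (z + t • v) e| = |coord B z e| + t * |coord B v e| := by
  have hmul : 0 ≤ coord B z e * (t * coord B v e) := by
    rw [mul_left_comm, mul_comm (coord B z e)]
    exact mul_nonneg ht (h e)
  rw [map_add, map_smul, Pi.add_apply, Pi.smul_apply, smul_eq_mul,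
    (abs_add_eq_add_abs_iff _ _).mpr (mul_nonneg_iff.mp hmul), abs_mul t, abs_of_nonneg ht]

variable [Finite E]

lemma Conforms.exists_sub_smul {v z : Fin r → ℝ} (hc : Conforms B v z)
    (hv : ∃ e, coord B v e ≠ 0) : ∃ t : ℝ, 0 < t ∧ SignAgree B v (z - t • v) ∧
      {e | coord B (z - t • v) e ≠ 0} ⊂ {e | coord B z e ≠ 0} := by
  obtain ⟨e₀, he₀, hmin⟩ := Set.exists_min_image {e | coord B v e ≠ 0}
    (fun e => |coord B z e| / |coord B v e|) (Set.toFinite _) hv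
  have hz₀ : coord B z e₀ ≠ 0 := mt (hc.mem_supportSpace e₀) he₀
  let t := |coord B z e₀| / |coord B v e₀|
  have hle (e) : t * |coord B v e| ≤ |coord B z e| := by
    by_cases he : coord B v e = 0
    · simp [he]
    · exact (le_div_iff₀ (abs_pos.mpr he)).mp (hmin e he)
  have hsub : {e | coord B (z - t • v) e ≠ 0} ⊆ {e | coord B z e ≠ 0} :=
    fun e he hz => he (by simp [hz, hc.mem_supportSpace e hz])
  refine ⟨t, div_pos (abs_pos.mpr hz₀) (abs_pos.mpr he₀), hc.signAgree.sub_smul hle,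
    (Set.ssubset_iff_of_subset hsub).mpr ⟨e₀, hz₀, not_not.mpr ?_⟩⟩
  have hratio : t = coord B z e₀ / coord B v e₀ := by
    rw [← abs_of_pos (a := coord B z e₀ / coord B v e₀), abs_div]
    rw [← mul_div_mul_left _ _ he₀]
    exact div_pos (hc e₀ he₀) (mul_self_pos.mpr he₀)
  simp [hratio, div_mul_cancel₀ _ he₀]

theorem IsRegular.induction (h : IsRegular B) {P : (Fin r → ℝ) → Prop} (zero : P 0)
    (add : ∀ (u : Fin r → ℤ) (t : ℝ) (z : Fin r → ℝ), IsSignVector B u → 0 < t →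
      SignAgree B (toReal u) z → P z → P (z + t • toReal u)) (z : Fin r → ℝ) : P z := by
  induction hn : {e | coord B z e ≠ 0}.ncard using Nat.strong_induction_on generalizing z with
  | _ n ih =>
    by_cases hz : z = 0
    · rwa [hz]
    obtain ⟨u, hu0, hus, huz⟩ := h.conformal z hz
    obtain ⟨t, ht, hagree, hlt⟩ :=
      huz.exists_sub_smul (h.exists_coord_ne_zero (toReal_ne_zero hu0))
    simpa using add u t _ hus ht hagree (ih _ (hn ▸ Set.ncard_lt_ncard hlt) _ rfl)

end Coordinates

section VoronoiCell

variable {E : Type*} {r : ℕ} [Fintype E] {B : Matrix (Fin r) E ℤ}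

lemma latticeForm_mul_transpose (u w : Fin r → ℤ) :
    latticeForm (B * Bᵀ) u w = ∑ e, (u ᵥ* B) e * (w ᵥ* B) e := by
  rw [latticeForm, ← Matrix.mulVec_mulVec, Matrix.dotProduct_mulVec, Matrix.mulVec_transpose]
  rfl

/-- The inner product on the real span as a bilinear form. -/
noncomputable def gramForm (B : Matrix (Fin r) E ℤ) : LinearMap.BilinForm ℝ (Fin r → ℝ) :=
  Matrix.toBilin' ((B * Bᵀ).map (fun a : ℤ => (a : ℝ)))

lemma gramForm_eq_realForm (x y : Fin r → ℝ) : gramForm B x y = realForm (B * Bᵀ) x y := by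
  rw [gramForm, Matrix.toBilin'_apply']; rfl

lemma gramForm_apply (x y : Fin r → ℝ) :
    gramForm B x y = ∑ e, coord B x e * coord B y e := by
  have h : (B * Bᵀ).map (fun a : ℤ => (a : ℝ)) =
      B.map (Int.cast : ℤ → ℝ) * (B.map (Int.cast : ℤ → ℝ))ᵀ := by
    ext i j
    simp [Matrix.mul_apply]
  rw [gramForm_eq_realForm, realForm, h, ← Matrix.mulVec_mulVec, Matrix.dotProduct_mulVec,
    Matrix.mulVec_transpose]
  rfl

lemma gramForm_comm (x y : Fin r → ℝ) : gramForm B x y = gramForm B y x := by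
  simp only [gramForm_apply, mul_comm]

lemma IsRegular.eq_zero_of_gramForm_self (h : IsRegular B) {z : Fin r → ℝ}
    (hz : gramForm B z z = 0) : z = 0 := by
  rw [gramForm_apply, Finset.sum_eq_zero_iff_of_nonneg fun e _ => mul_self_nonneg _] at hz
  exact h.inj z (funext fun e => mul_self_eq_zero.mp (hz e (Finset.mem_univ e)))

lemma IsRegular.nondegenerate (h : IsRegular B) : (gramForm B).Nondegenerate :=
  ⟨fun x hx => h.eq_zero_of_gramForm_self (hx x), fun x hx => h.eq_zero_of_gramForm_self (hx x)⟩

/-- The sum of the absolute values of the coordinates. -/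
noncomputable def normOne (B : Matrix (Fin r) E ℤ) (z : Fin r → ℝ) : ℝ := ∑ e, |coord B z e|

lemma normOne_nonneg (z : Fin r → ℝ) : 0 ≤ normOne B z := Finset.sum_nonneg fun _ _ => abs_nonneg _

lemma normOne_smul {t : ℝ} (ht : 0 ≤ t) (z : Fin r → ℝ) : normOne B (t • z) = t * normOne B z := by
  simp [normOne, Finset.mul_sum, abs_mul, abs_of_nonneg ht]

lemma SignAgree.normOne_add_smul {v z : Fin r → ℝ} (h : SignAgree B v z) {t : ℝ} (ht : 0 ≤ t) :
    normOne B (z + t • v) = normOne B z + t * normOne B v := by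
  simp only [normOne, h.abs_coord_add_smul ht, Finset.sum_add_distrib, Finset.mul_sum]

lemma abs_le_mul_self (a : ℤ) : |a| ≤ a * a := by
  rw [← Int.natCast_natAbs, ← Int.natAbs_mul_self]
  exact_mod_cast Nat.le_mul_self _

lemma mul_self_eq_abs_of_abs_le_one {a : ℤ} (h : |a| ≤ 1) : a * a = |a| :=
  (abs_mul_abs_self a ▸ mul_le_of_le_one_left (abs_nonneg a) h).antisymm (abs_le_mul_self a)

lemma IsSignVector.gramForm_self {u : Fin r → ℤ} (hu : IsSignVector B u) :
    gramForm B (toReal u) (toReal u) = normOne B (toReal u) := by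
  simp only [gramForm_apply, normOne, coord_toReal]
  exact_mod_cast Finset.sum_congr rfl fun e _ => mul_self_eq_abs_of_abs_le_one (hu e)

lemma normOne_le_gramForm_self (v : Fin r → ℤ) :
    normOne B (toReal v) ≤ gramForm B (toReal v) (toReal v) := by
  simp only [gramForm_apply, normOne, coord_toReal]
  exact_mod_cast Finset.sum_le_sum fun e _ => abs_le_mul_self ((v ᵥ* B) e)

lemma mem_voronoiCell_iff (x : Fin r → ℝ) : x ∈ voronoiCell (B * Bᵀ) ↔
    ∀ v : Fin r → ℤ, gramForm B x (toReal v) ≤ gramForm B (toReal v) (toReal v) / 2 := by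
  refine forall_congr' fun v => ?_
  simp only [← gramForm_eq_realForm, map_sub, LinearMap.sub_apply, gramForm_comm (toReal v) x]
  constructor <;> intro h <;> linarith

lemma zero_mem_voronoiCell : (0 : Fin r → ℝ) ∈ voronoiCell (B * Bᵀ) := by
  refine (mem_voronoiCell_iff 0).mpr fun v => ?_
  have hv := (normOne_nonneg _).trans (normOne_le_gramForm_self (B := B) v)
  rw [map_zero, LinearMap.zero_apply]
  exact div_nonneg hv zero_le_two

theorem IsRegular.gramForm_le_normOne (h : IsRegular B) {x : Fin r → ℝ}
    (hx : x ∈ voronoiCell (B * Bᵀ)) (z : Fin r → ℝ) : gramForm B x z ≤ normOne B z / 2 := by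
  induction z using h.induction with
  | zero => simp [normOne]
  | add u t z hu ht hagree ih =>
    have hu2 := (mem_voronoiCell_iff x).mp hx u
    rw [hu.gramForm_self] at hu2
    rw [hagree.normOne_add_smul ht.le, map_add, map_smul, smul_eq_mul]
    linarith [mul_le_mul_of_nonneg_left hu2 ht.le]

/-- The coordinate functional of `e`. -/
noncomputable def coordFun (B : Matrix (Fin r) E ℤ) (e : E) : Module.Dual ℝ (Fin r → ℝ) :=
  LinearMap.proj e ∘ₗ coord B

/-- The vector representing the coordinate functional of `e`. -/
noncomputable def IsRegular.edgeVec (h : IsRegular B) (e : E) : Fin r → ℝ :=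
  ((gramForm B).toDual h.nondegenerate).symm (coordFun B e)

lemma IsRegular.gramForm_edgeVec (h : IsRegular B) (e : E) (y : Fin r → ℝ) :
    gramForm B (h.edgeVec e) y = coord B y e :=
  LinearMap.BilinForm.apply_toDual_symm_apply _ _

lemma IsRegular.gramForm_sum_smul_edgeVec (h : IsRegular B) (t : E → ℝ) (y : Fin r → ℝ) :
    gramForm B (∑ e, t e • h.edgeVec e) y = ∑ e, t e * coord B y e := by
  simp [LinearMap.sum_apply, h.gramForm_edgeVec]

lemma IsRegular.sum_smul_edgeVec_mem_voronoiCell (h : IsRegular B) {t : E → ℝ}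
    (ht : ∀ e, |t e| ≤ 1 / 2) : ∑ e, t e • h.edgeVec e ∈ voronoiCell (B * Bᵀ) := by
  refine (mem_voronoiCell_iff _).mpr fun v => ?_
  calc gramForm B (∑ e, t e • h.edgeVec e) (toReal v)
      = ∑ e, t e * coord B (toReal v) e := h.gramForm_sum_smul_edgeVec t _
    _ ≤ ∑ e, |coord B (toReal v) e| / 2 := by
        refine Finset.sum_le_sum fun e _ => (le_abs_self _).trans ?_
        rw [abs_mul]
        linarith [mul_le_mul_of_nonneg_right (ht e) (abs_nonneg (coord B (toReal v) e))]
    _ = normOne B (toReal v) / 2 := by rw [normOne, Finset.sum_div]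
    _ ≤ _ := by linarith [normOne_le_gramForm_self (B := B) v]

/-- The face of the Voronoi cell in the direction `z`: for regular `B` the maximum of the form with
`z` over the cell is `normOne B z / 2`. -/
def dirFace (B : Matrix (Fin r) E ℤ) (z : Fin r → ℝ) : Set (Fin r → ℝ) :=
  {x ∈ voronoiCell (B * Bᵀ) | gramForm B x z = normOne B z / 2}

lemma IsRegular.sum_smul_edgeVec_mem_dirFace (h : IsRegular B) {z : Fin r → ℝ} {t : E → ℝ}
    (ht : ∀ e, |t e| ≤ 1 / 2) (htz : ∀ e, t e * coord B z e = |coord B z e| / 2) :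
    ∑ e, t e • h.edgeVec e ∈ dirFace B z := by
  refine ⟨h.sum_smul_edgeVec_mem_voronoiCell ht, ?_⟩
  rw [h.gramForm_sum_smul_edgeVec, normOne, Finset.sum_div]
  exact Finset.sum_congr rfl fun e _ => htz e

lemma abs_half_sign_le (a : ℝ) : |(SignType.sign a : ℝ) / 2| ≤ 1 / 2 := by
  rcases lt_trichotomy a 0 with h | h | h <;> simp [h, abs_div]

lemma half_sign_mul_self (a : ℝ) : (SignType.sign a : ℝ) / 2 * a = |a| / 2 := by
  rw [div_mul_eq_mul_div, sign_mul_self]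

lemma IsRegular.dirFace_nonempty (h : IsRegular B) (z : Fin r → ℝ) : (dirFace B z).Nonempty :=
  ⟨_, h.sum_smul_edgeVec_mem_dirFace (fun e => abs_half_sign_le (coord B z e))
    fun _ => half_sign_mul_self _⟩

lemma IsRegular.mem_dirFace_iff_forall_le (h : IsRegular B) (z x : Fin r → ℝ) :
    x ∈ dirFace B z ↔ x ∈ voronoiCell (B * Bᵀ) ∧
      ∀ y ∈ voronoiCell (B * Bᵀ), gramForm B y z ≤ gramForm B x z := by
  obtain ⟨p, hp, hpz⟩ := h.dirFace_nonempty z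
  refine and_congr_right fun hx => ⟨fun hxz y hy => ?_, fun hmax => ?_⟩
  · exact hxz ▸ h.gramForm_le_normOne hy z
  · exact (h.gramForm_le_normOne hx z).antisymm (hpz ▸ hmax p hp)

theorem IsRegular.isFace_iff (h : IsRegular B) (F : Set (Fin r → ℝ)) :
    IsFace (B * Bᵀ) F ↔ ∃ z, F = dirFace B z := by
  constructor
  · rintro ⟨hne, hF⟩
    obtain ⟨l, hl⟩ := hF hne
    refine ⟨((gramForm B).toDual h.nondegenerate).symm l, hl.trans (Set.ext fun x => ?_)⟩
    simp only [h.mem_dirFace_iff_forall_le, gramForm_comm _ (LinearEquiv.symm _ _),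
      LinearMap.BilinForm.apply_toDual_symm_apply]
    rfl
  · rintro ⟨z, rfl⟩
    refine ⟨h.dirFace_nonempty z, fun _ =>
      ⟨LinearMap.toContinuousLinearMap (gramForm B z), Set.ext fun x => ?_⟩⟩
    simp only [h.mem_dirFace_iff_forall_le, gramForm_comm _ z]
    rfl

end VoronoiCell

section Faces

variable {E : Type*} {r : ℕ} [Fintype E] {B : Matrix (Fin r) E ℤ}

lemma dirFace_smul {t : ℝ} (ht : 0 < t) (z : Fin r → ℝ) : dirFace B (t • z) = dirFace B z := by
  ext x
  refine and_congr_right fun _ => ?_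
  rw [map_smul, smul_eq_mul, normOne_smul ht.le, mul_div_assoc, mul_right_inj' ht.ne']

lemma SignAgree.normOne_add {u v : Fin r → ℝ} (h : SignAgree B u v) :
    normOne B (u + v) = normOne B u + normOne B v := by
  simpa [add_comm] using h.normOne_add_smul zero_le_one

lemma IsRegular.dirFace_add_subset_left (h : IsRegular B) {u v : Fin r → ℝ}
    (huv : SignAgree B u v) : dirFace B (u + v) ⊆ dirFace B u := by
  rintro x ⟨hx, hxuv⟩
  refine ⟨hx, (h.gramForm_le_normOne hx u).antisymm ?_⟩
  rw [map_add, huv.normOne_add] at hxuv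
  linarith [h.gramForm_le_normOne hx v]

lemma IsRegular.signAgree_of_mem_dirFace (h : IsRegular B) {u v x : Fin r → ℝ}
    (hu : x ∈ dirFace B u) (hv : x ∈ dirFace B v) : SignAgree B u v := by
  have hle := h.gramForm_le_normOne hu.1 (u + v)
  have hnn (e) (_ : e ∈ Finset.univ) :
      0 ≤ |coord B u e| + |coord B v e| - |coord B (u + v) e| := by
    rw [map_add, Pi.add_apply, sub_nonneg]
    exact abs_add_le _ _
  have hsum : ∑ e, (|coord B u e| + |coord B v e| - |coord B (u + v) e|) = 0 := by
    refine le_antisymm ?_ (Finset.sum_nonneg hnn)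
    rw [map_add, hu.2, hv.2] at hle
    simp only [Finset.sum_sub_distrib, Finset.sum_add_distrib]
    simp only [normOne] at hle
    linarith
  intro e
  have he := (Finset.sum_eq_zero_iff_of_nonneg hnn).mp hsum e (Finset.mem_univ e)
  rw [mul_nonneg_iff, ← abs_add_eq_add_abs_iff]
  simpa using (sub_eq_zero.mp he).symm

lemma IsRegular.dirFace_inter_nonempty_iff (h : IsRegular B) {u v : Fin r → ℝ} :
    (dirFace B u ∩ dirFace B v).Nonempty ↔ SignAgree B u v := by
  refine ⟨fun ⟨x, hu, hv⟩ => h.signAgree_of_mem_dirFace hu hv, fun huv => ?_⟩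
  obtain ⟨x, hx⟩ := h.dirFace_nonempty (u + v)
  exact ⟨x, h.dirFace_add_subset_left huv hx,
    h.dirFace_add_subset_left huv.symm (add_comm u v ▸ hx)⟩

lemma exists_pos_mul_abs_lt {ι : Type*} [Finite ι] (a b : ι → ℝ) :
    ∃ ε : ℝ, 0 < ε ∧ ∀ i, a i ≠ 0 → |ε * b i| < |a i| := by
  have hev : ∀ᶠ ε in nhdsWithin (0 : ℝ) (Set.Ioi 0), ∀ i, a i ≠ 0 → |ε * b i| < |a i| := by
    refine Filter.eventually_all.mpr fun i => Filter.eventually_imp_distrib_left.mpr fun ha => ?_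
    have hcont : Continuous fun ε : ℝ => |ε * b i| := by fun_prop
    refine ((hcont.tendsto 0).mono_left nhdsWithin_le_nhds).eventually_lt_const ?_
    simpa using ha
  obtain ⟨ε, hε, hpos⟩ := (hev.and self_mem_nhdsWithin).exists
  exact ⟨ε, hpos, hε⟩

lemma mul_add_self_pos {a b : ℝ} (h : |b| < |a|) : 0 < a * (a + b) := by
  have hab : |a| * |b| < |a| * |a| := mul_lt_mul_of_pos_left h ((abs_nonneg b).trans_lt h)
  rw [← abs_mul, abs_mul_abs_self] at hab
  linarith [neg_abs_le (a * b)]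

omit [Fintype E] in
lemma exists_pos_signAgree_add_sub [Finite E] {z y : Fin r → ℝ} (hy : y ∈ supportSpace B z) :
    ∃ ε : ℝ, 0 < ε ∧ SignAgree B (z + ε • y) (z - ε • y) := by
  obtain ⟨ε, hε, hlt⟩ := exists_pos_mul_abs_lt (coord B z) (coord B y)
  refine ⟨ε, hε, fun e => ?_⟩
  rw [map_add, map_sub, map_smul, Pi.add_apply, Pi.sub_apply, ← sq_sub_sq, sub_nonneg, sq_le_sq]
  by_cases he : coord B z e = 0
  · simp [he, hy e he]
  · exact (hlt e he).le

lemma IsRegular.exists_dirFace_subset_add (h : IsRegular B) {z y : Fin r → ℝ}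
    (hy : y ∈ supportSpace B z) : ∃ ε : ℝ, 0 < ε ∧ dirFace B z ⊆ dirFace B (z + ε • y) := by
  obtain ⟨ε, hε, hagree⟩ := exists_pos_signAgree_add_sub hy
  have htwo : (2 : ℝ) • z = z + ε • y + (z - ε • y) := by rw [two_smul]; abel
  exact ⟨ε, hε, by
    simpa only [← htwo, dirFace_smul two_pos] using h.dirFace_add_subset_left hagree⟩

theorem IsRegular.dirFace_anti (h : IsRegular B) {v z : Fin r → ℝ} (hc : Conforms B v z) :
    dirFace B z ⊆ dirFace B v := by
  obtain ⟨ε, hε, hlt⟩ := exists_pos_mul_abs_lt (coord B z) (coord B v)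
  have hagree : SignAgree B (ε • v) (z - ε • v) := by
    intro e
    have hle : ε * |coord B v e| ≤ |coord B z e| := by
      by_cases he : coord B z e = 0
      · simp [he, hc.mem_supportSpace e he]
      · simpa [abs_mul, abs_of_pos hε] using (hlt e he).le
    simpa [mul_assoc] using mul_nonneg hε.le (mul_sub_mul_nonneg (hc.signAgree e) hle)
  simpa only [add_sub_cancel, dirFace_smul hε] using h.dirFace_add_subset_left hagree

lemma IsRegular.gramForm_eq_of_mem_dirFace (h : IsRegular B) {z y p q : Fin r → ℝ}
    (hy : y ∈ supportSpace B z) (hp : p ∈ dirFace B z) (hq : q ∈ dirFace B z) :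
    gramForm B p y = gramForm B q y := by
  obtain ⟨ε, hε, hsub⟩ := h.exists_dirFace_subset_add hy
  have hpq := (hsub hp).2.trans (hsub hq).2.symm
  rw [map_add, map_add, map_smul, map_smul, hp.2, hq.2, add_right_inj] at hpq
  exact mul_left_cancel₀ hε.ne' hpq

lemma IsRegular.edgeVec_mem_vectorSpan_of_eq_zero (h : IsRegular B) {z : Fin r → ℝ} {e : E}
    (he : coord B z e = 0) : h.edgeVec e ∈ vectorSpan ℝ (dirFace B z) := by
  classical
  let s (f : E) : ℝ := SignType.sign (coord B z f) / 2
  have hs : ∑ f, s f • h.edgeVec f ∈ dirFace B z :=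
    h.sum_smul_edgeVec_mem_dirFace (fun _ => abs_half_sign_le _) fun _ => half_sign_mul_self _
  have hs' : ∑ f, (s f + Pi.single (M := fun _ => ℝ) e (1 / 2) f) • h.edgeVec f ∈
      dirFace B z := by
    refine h.sum_smul_edgeVec_mem_dirFace (fun f => ?_) (fun f => ?_) <;>
      rcases eq_or_ne f e with rfl | hf
    · simp [s, he]
    · simpa [s, hf] using abs_half_sign_le (coord B z f)
    · simp [he]
    · simpa [s, hf] using half_sign_mul_self (coord B z f)
  have hdiff := vsub_mem_vectorSpan ℝ hs' hs
  simp only [add_smul, Finset.sum_add_distrib, vsub_eq_sub, add_sub_cancel_left, Pi.single_apply,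
    ite_smul, zero_smul, Finset.sum_ite_eq', Finset.mem_univ, if_true] at hdiff
  exact (Submodule.smul_mem_iff _ (by norm_num)).mp hdiff

lemma mem_orthogonal_vectorSpan_iff {S : Set (Fin r → ℝ)} {y : Fin r → ℝ} :
    y ∈ (gramForm B).orthogonal (vectorSpan ℝ S) ↔
      ∀ p ∈ S, ∀ q ∈ S, gramForm B p y = gramForm B q y := by
  have hle : y ∈ (gramForm B).orthogonal (vectorSpan ℝ S) ↔
      vectorSpan ℝ S ≤ LinearMap.ker ((gramForm B).flip y) := Iff.rfl
  rw [hle, vectorSpan_def, Submodule.span_le, Set.vsub_subset_iff]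
  simp [sub_eq_zero]

theorem IsRegular.orthogonal_vectorSpan (h : IsRegular B) (z : Fin r → ℝ) :
    (gramForm B).orthogonal (vectorSpan ℝ (dirFace B z)) = supportSpace B z := by
  ext y
  constructor
  · intro hy e he
    rw [← h.gramForm_edgeVec]
    exact hy _ (h.edgeVec_mem_vectorSpan_of_eq_zero he)
  · exact fun hy => mem_orthogonal_vectorSpan_iff.mpr fun p hp q hq =>
      h.gramForm_eq_of_mem_dirFace hy hp hq

lemma IsRegular.finrank_vectorSpan_add (h : IsRegular B) (z : Fin r → ℝ) :
    Module.finrank ℝ (vectorSpan ℝ (dirFace B z)) + Module.finrank ℝ (supportSpace B z) = r := by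
  have horth := LinearMap.BilinForm.finrank_orthogonal h.nondegenerate
    (vectorSpan ℝ (dirFace B z))
  have hle := Submodule.finrank_le (vectorSpan ℝ (dirFace B z))
  rw [h.orthogonal_vectorSpan] at horth
  simp only [Module.finrank_fin_fun] at horth hle
  omega

lemma IsRegular.edgeVec_mem_vectorSpan_iff (h : IsRegular B) (z : Fin r → ℝ) (e : E) :
    h.edgeVec e ∈ vectorSpan ℝ (dirFace B z) ↔ coord B z e = 0 := by
  refine ⟨fun he => ?_, h.edgeVec_mem_vectorSpan_of_eq_zero⟩
  have hz := h.orthogonal_vectorSpan z ▸ mem_supportSpace_self (B := B) z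
  exact h.gramForm_edgeVec e z ▸ hz _ he

lemma IsRegular.finite_isFace (h : IsRegular B) : {F | IsFace (B * Bᵀ) F}.Finite := by
  let pattern (z : Fin r → ℝ) (e : E) : SignType := SignType.sign (coord B z e)
  have hanti {z z'} (hzz : pattern z = pattern z') : dirFace B z' ⊆ dirFace B z := by
    refine h.dirFace_anti fun e he => ?_
    have hsign : SignType.sign (coord B z e) = SignType.sign (coord B z' e) := congrFun hzz e
    rwa [← sign_eq_one_iff, sign_mul, ← hsign, ← sign_mul, sign_eq_one_iff, mul_self_pos]
  refine ((Set.toFinite (Set.univ : Set (E → SignType))).image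
    fun p => dirFace B (Function.invFun pattern p)).subset fun F hF => ?_
  obtain ⟨z, rfl⟩ := (h.isFace_iff F).mp hF
  have hinv : pattern (Function.invFun pattern (pattern z)) = pattern z :=
    Function.invFun_eq ⟨z, rfl⟩
  exact ⟨pattern z, trivial, (hanti hinv.symm).antisymm (hanti hinv)⟩

end Faces

section Facets

variable {E : Type*} {r : ℕ} {B : Matrix (Fin r) E ℤ}

/-- The lattice vectors with coordinates in `{-1, 0, 1}` and minimal support; for the lattice of
integer flows these are the circuit elements. -/
structure IsElementary (B : Matrix (Fin r) E ℤ) (v : Fin r → ℤ) : Prop where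
  ne_zero : v ≠ 0
  sign : IsSignVector B v
  eq_smul : ∀ y ∈ supportSpace B (toReal v), ∃ t : ℝ, y = t • toReal v

lemma IsElementary.finrank_supportSpace {v : Fin r → ℤ} (hv : IsElementary B v) :
    Module.finrank ℝ (supportSpace B (toReal v)) = 1 := by
  refine finrank_eq_one ⟨toReal v, mem_supportSpace_self _⟩
    (fun h0 => toReal_ne_zero hv.ne_zero (congrArg Subtype.val h0)) fun ⟨y, hy⟩ => ?_
  obtain ⟨t, rfl⟩ := hv.eq_smul y hy
  exact ⟨t, rfl⟩

lemma IsRegular.supportSpace_zero (h : IsRegular B) : supportSpace B 0 = ⊥ :=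
  (Submodule.eq_bot_iff _).mpr fun y hy => h.inj y (funext fun e => hy e (by simp))

lemma IsRegular.exists_isElementary_of_finrank_eq_one (h : IsRegular B) {z : Fin r → ℝ}
    (hz : Module.finrank ℝ (supportSpace B z) = 1) :
    ∃ u, IsElementary B u ∧ Conforms B (toReal u) z ∧ ∃ t : ℝ, z = t • toReal u := by
  have hz0 : z ≠ 0 := by
    rintro rfl
    rw [h.supportSpace_zero, finrank_bot] at hz
    exact zero_ne_one hz
  obtain ⟨u, hu0, hus, huz⟩ := h.conformal z hz0
  have hspan (y) (hy : y ∈ supportSpace B z) : ∃ t : ℝ, y = t • toReal u := by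
    have hu : (⟨toReal u, huz.mem_supportSpace⟩ : supportSpace B z) ≠ 0 := fun h0 =>
      toReal_ne_zero hu0 (congrArg Subtype.val h0)
    obtain ⟨t, ht⟩ := (finrank_eq_one_iff_of_nonzero' _ hu).mp hz ⟨y, hy⟩
    exact ⟨t, congrArg Subtype.val ht.symm⟩
  exact ⟨u, ⟨hu0, hus, fun y hy => hspan y (supportSpace_le huz.mem_supportSpace hy)⟩, huz,
    hspan z (mem_supportSpace_self z)⟩

variable [Fintype E]

lemma IsSignVector.bisectorFace_eq {v : Fin r → ℤ} (hv : IsSignVector B v) :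
    bisectorFace (B * Bᵀ) v = dirFace B (toReal v) := by
  simp only [bisectorFace, dirFace, ← gramForm_eq_realForm, hv.gramForm_self]

lemma IsRegular.isFacet_dirFace_iff (h : IsRegular B) (z : Fin r → ℝ) :
    IsFacet (B * Bᵀ) (dirFace B z) ↔ Module.finrank ℝ (supportSpace B z) = 1 := by
  have hsum := h.finrank_vectorSpan_add z
  rw [IsFacet, and_iff_right ((h.isFace_iff _).mpr ⟨z, rfl⟩)]
  omega

lemma IsRegular.isFacet_of_isElementary (h : IsRegular B) {v : Fin r → ℤ}
    (hv : IsElementary B v) : IsFacet (B * Bᵀ) (bisectorFace (B * Bᵀ) v) := by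
  rw [hv.sign.bisectorFace_eq, h.isFacet_dirFace_iff, hv.finrank_supportSpace]

lemma IsRegular.exists_isElementary_of_isFacet (h : IsRegular B) {F : Set (Fin r → ℝ)}
    (hF : IsFacet (B * Bᵀ) F) : ∃ v, IsElementary B v ∧ F = bisectorFace (B * Bᵀ) v := by
  obtain ⟨z, rfl⟩ := (h.isFace_iff F).mp hF.1
  obtain ⟨u, hu, huz, t, rfl⟩ :=
    h.exists_isElementary_of_finrank_eq_one ((h.isFacet_dirFace_iff z).mp hF)
  refine ⟨u, hu, ?_⟩
  rw [hu.sign.bisectorFace_eq]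
  refine (h.dirFace_anti huz).antisymm (h.dirFace_anti fun e he => ?_)
  rw [mul_comm]
  exact huz e fun h0 => he (by simp [h0])

lemma IsRegular.zero_mem_bisectorFace_iff (h : IsRegular B) (v : Fin r → ℤ) :
    0 ∈ bisectorFace (B * Bᵀ) v ↔ v = 0 := by
  have hform : (0 : ℝ) = gramForm B (toReal v) (toReal v) / 2 ↔ v = 0 := by
    refine ⟨fun h0 => ?_, fun h0 => by simp [h0]⟩
    by_contra hv
    exact toReal_ne_zero hv (h.eq_zero_of_gramForm_self (by linarith))
  rw [← hform, bisectorFace, Set.mem_sep_iff, and_iff_right zero_mem_voronoiCell]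
  simp only [← gramForm_eq_realForm, map_zero, LinearMap.zero_apply]

lemma IsRegular.eq_of_bisectorFace_eq (h : IsRegular B) {u v : Fin r → ℤ}
    (hu : IsElementary B u) (huv : bisectorFace (B * Bᵀ) u = bisectorFace (B * Bᵀ) v) :
    u = v := by
  have hv : v ≠ 0 := by
    rw [ne_eq, ← h.zero_mem_bisectorFace_iff, ← huv, h.zero_mem_bisectorFace_iff]
    exact hu.ne_zero
  have hform (x) (hx : x ∈ dirFace B (toReal u)) :
      gramForm B x (toReal v) = gramForm B (toReal v) (toReal v) / 2 := by
    rw [← hu.sign.bisectorFace_eq, huv] at hx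
    simpa only [gramForm_eq_realForm] using hx.2
  obtain ⟨c, hc⟩ := hu.eq_smul (toReal v) <| by
    rw [← h.orthogonal_vectorSpan, mem_orthogonal_vectorSpan_iff]
    exact fun p hp q hq => (hform p hp).trans (hform q hq).symm
  obtain ⟨x, hx⟩ := h.dirFace_nonempty (toReal u)
  have hform_u : gramForm B (toReal u) (toReal u) ≠ 0 :=
    mt h.eq_zero_of_gramForm_self (toReal_ne_zero hu.ne_zero)
  have hc0 : c ≠ 0 := by
    rintro rfl
    exact toReal_ne_zero hv (by simpa using hc)
  have hc1 : c = 1 := by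
    have hx2 := hx.2
    have hxv := hform x hx
    rw [← hu.sign.gramForm_self] at hx2
    simp only [hc, map_smul, LinearMap.smul_apply, smul_eq_mul, hx2] at hxv
    refine mul_left_cancel₀ hc0 (mul_right_cancel₀ hform_u ?_)
    linarith
  rw [hc1, one_smul] at hc
  exact (toReal_injective hc).symm

theorem IsRegular.isFacet_bisectorFace_iff (h : IsRegular B) (v : Fin r → ℤ) :
    IsFacet (B * Bᵀ) (bisectorFace (B * Bᵀ) v) ↔ IsElementary B v := by
  refine ⟨fun hF => ?_, h.isFacet_of_isElementary⟩
  obtain ⟨u, hu, huv⟩ := h.exists_isElementary_of_isFacet hF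
  rwa [← h.eq_of_bisectorFace_eq hu huv.symm]

theorem IsRegular.existsUnique_of_isFacet (h : IsRegular B) {F : Set (Fin r → ℝ)}
    (hF : IsFacet (B * Bᵀ) F) : ∃! v, F = bisectorFace (B * Bᵀ) v := by
  obtain ⟨u, hu, rfl⟩ := h.exists_isElementary_of_isFacet hF
  exact ⟨u, rfl, fun v hv => (h.eq_of_bisectorFace_eq hu hv).symm⟩

end Facets

section Functionals

variable {V ι : Type*} [AddCommGroup V] [Module ℝ V]

lemma exists_ker_generic [Finite ι] (φ : Module.Dual ℝ V) (ψ : ι → Module.Dual ℝ V) :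
    ∃ z, φ z = 0 ∧ ∀ i, ψ i z = 0 → ∀ y, φ y = 0 → ψ i y = 0 := by
  obtain ⟨z, hz, hzi⟩ := Module.Dual.exists_forall_mem_ne_zero_of_forall_exists
    (LinearMap.ker φ) (fun i : {i // ∃ y, φ y = 0 ∧ ψ i y ≠ 0} => ψ i.1) fun i => i.2
  refine ⟨z, hz, fun i hi y hy => ?_⟩
  by_contra hne
  exact hzi ⟨i, y, hy, hne⟩ hi

lemma abs_add_add_abs_sub {a b : ℝ} (h : |b| ≤ |a|) : |a + b| + |a - b| = 2 * |a| := by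
  have hab : 0 ≤ (a + b) * (a - b) := by
    rw [← sq_sub_sq, sub_nonneg, sq_le_sq]
    exact h
  rw [← (abs_add_eq_add_abs_iff _ _).mpr (mul_nonneg_iff.mp hab), add_add_sub_cancel, ← two_mul,
    abs_mul, abs_two]

/-- The second difference of `∑ i, d i * |w i|` at a generic zero of `w k` only sees the `k`-th
summand. -/
theorem linearIndependent_abs [Finite ι] {w : ι → Module.Dual ℝ V} (hne : ∀ i, w i ≠ 0)
    (hker : Pairwise fun i j => ∃ z, w i z = 0 ∧ w j z ≠ 0) :
    LinearIndependent ℝ fun i z => |w i z| := by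
  have := Fintype.ofFinite ι
  refine Fintype.linearIndependent_iff.mpr fun d hd k => ?_
  replace hd (z) : ∑ i, d i * |w i z| = 0 := by simpa using congrFun hd z
  obtain ⟨z, hz, hzi⟩ := exists_ker_generic (w k) w
  have hzi (i) (hi : i ≠ k) : w i z ≠ 0 := fun h0 => by
    obtain ⟨y, hy, hyi⟩ := hker hi.symm
    exact hyi (hzi i h0 y hy)
  obtain ⟨y, hy⟩ : ∃ y, w k y ≠ 0 := DFunLike.ne_iff.mp (hne k)
  obtain ⟨ε, hε, hlt⟩ := exists_pos_mul_abs_lt (fun i => w i z) (fun i => w i y)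
  have hdiff : ∑ i, d i * (|w i (z + ε • y)| + |w i (z - ε • y)| - 2 * |w i z|) =
      d k * (2 * |ε * w k y|) := by
    rw [Fintype.sum_eq_single k fun i hi => ?_]
    · simp only [map_add, map_sub, map_smul, smul_eq_mul, hz, zero_add, zero_sub, abs_neg, abs_zero,
        mul_zero, sub_zero, two_mul]
    · simp only [map_add, map_sub, map_smul, smul_eq_mul, abs_add_add_abs_sub (hlt i (hzi i hi)).le,
        sub_self, mul_zero]
  have hzero : ∑ i, d i * (|w i (z + ε • y)| + |w i (z - ε • y)| - 2 * |w i z|) = 0 := by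
    simp only [mul_sub, mul_add, mul_left_comm _ (2 : ℝ), Finset.sum_sub_distrib,
      Finset.sum_add_distrib, ← Finset.mul_sum, hd, add_zero, mul_zero, sub_zero]
  simpa [hε.ne', hy] using hdiff.symm.trans hzero

end Functionals

section EdgeClasses

variable {E : Type*} {r : ℕ} {B : Matrix (Fin r) E ℤ}

/-- The `f`-th coordinate is a multiple of the `e`-th one. -/
def ParallelCoords (B : Matrix (Fin r) E ℤ) (e f : E) : Prop :=
  ∀ z, coord B z e = 0 → coord B z f = 0

lemma exists_coord_eq_zero_iff [Finite E] (e : E) :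
    ∃ z, ∀ f, coord B z f = 0 ↔ ParallelCoords B e f := by
  obtain ⟨z, hz, hzf⟩ := exists_ker_generic (coordFun B e) (coordFun B)
  exact ⟨z, fun f => ⟨hzf f, fun hp => hp z hz⟩⟩

lemma IsRegular.coordFun_ne_zero (h : IsRegular B) (e : E) : coordFun B e ≠ 0 := by
  obtain ⟨i, hi⟩ := h.col_ne e
  intro h0
  have := LinearMap.congr_fun h0 (Pi.single i 1)
  simp [coordFun, coord_apply, Pi.single_apply, hi] at this

variable [Fintype E]

lemma IsRegular.edgeVec_ne_zero (h : IsRegular B) (e : E) : h.edgeVec e ≠ 0 := by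
  rw [edgeVec, ne_eq, LinearEquiv.map_eq_zero_iff]
  exact h.coordFun_ne_zero e

lemma IsRegular.edgeVec_mem_span_iff (h : IsRegular B) (e f : E) :
    h.edgeVec f ∈ Submodule.span ℝ {h.edgeVec e} ↔ ParallelCoords B e f := by
  constructor
  · intro hf z hz
    obtain ⟨t, ht⟩ := Submodule.mem_span_singleton.mp hf
    rw [← h.gramForm_edgeVec, ← ht, map_smul, LinearMap.smul_apply, h.gramForm_edgeVec, hz,
      smul_zero]
  · intro hp
    have hrefl : (gramForm B).IsRefl := fun x y hxy => (gramForm_comm y x).trans hxy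
    rw [← LinearMap.BilinForm.orthogonal_orthogonal h.nondegenerate hrefl
      (Submodule.span ℝ {h.edgeVec e})]
    intro y hy
    change gramForm B y _ = 0
    rw [gramForm_comm, h.gramForm_edgeVec]
    refine hp y ?_
    rw [← h.gramForm_edgeVec]
    exact hy _ (Submodule.mem_span_singleton_self _)

lemma IsRegular.vectorSpan_eq_span (h : IsRegular B) (ε : VoronoiEdge (B * Bᵀ)) {e : E}
    (he : h.edgeVec e ∈ vectorSpan ℝ ε.1) :
    vectorSpan ℝ ε.1 = Submodule.span ℝ {h.edgeVec e} := by
  refine (Submodule.eq_of_le_of_finrank_eq ?_ ?_).symm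
  · rwa [Submodule.span_le, Set.singleton_subset_iff]
  · rw [finrank_span_singleton (h.edgeVec_ne_zero e), ε.2.2]

lemma IsRegular.exists_edgeVec_mem_vectorSpan (h : IsRegular B) (ε : VoronoiEdge (B * Bᵀ)) :
    ∃ e, h.edgeVec e ∈ vectorSpan ℝ ε.1 := by
  obtain ⟨z, hz⟩ := (h.isFace_iff _).mp ε.2.1
  by_contra! hcon
  simp only [hz, h.edgeVec_mem_vectorSpan_iff] at hcon
  have htop : supportSpace B z = ⊤ := eq_top_iff.mpr fun y _ e he => absurd he (hcon e)
  have hsum := h.finrank_vectorSpan_add z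
  rw [htop, finrank_top, Module.finrank_fin_fun, ← hz, ε.2.2] at hsum
  omega

/-- The coordinates whose direction is that of the parallel class `c`; for the lattice of integer
flows these are the 2-cut blocks. -/
def IsRegular.classEdges (h : IsRegular B) (c : EdgeClass (B * Bᵀ)) : Set E :=
  Quotient.lift (fun ε : VoronoiEdge (B * Bᵀ) => {e | h.edgeVec e ∈ vectorSpan ℝ ε.1})
    (fun ε ε' (hε : vectorSpan ℝ ε.1 = vectorSpan ℝ ε'.1) => by simp only [hε]) c

lemma IsRegular.mem_classEdges_mk (h : IsRegular B) (ε : VoronoiEdge (B * Bᵀ)) (e : E) :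
    e ∈ h.classEdges (Quotient.mk (parallel _) ε) ↔ h.edgeVec e ∈ vectorSpan ℝ ε.1 := Iff.rfl

lemma IsRegular.classEdges_nonempty (h : IsRegular B) (c : EdgeClass (B * Bᵀ)) :
    (h.classEdges c).Nonempty := by
  induction c using Quotient.inductionOn with
  | h ε => exact h.exists_edgeVec_mem_vectorSpan ε

lemma IsRegular.mem_classEdges_iff (h : IsRegular B) {c : EdgeClass (B * Bᵀ)} {e : E}
    (he : e ∈ h.classEdges c) (f : E) : f ∈ h.classEdges c ↔ ParallelCoords B e f := by
  induction c using Quotient.inductionOn with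
  | h ε =>
    rw [h.mem_classEdges_mk] at he ⊢
    rw [h.vectorSpan_eq_span ε he, h.edgeVec_mem_span_iff]

lemma IsRegular.eq_of_mem_classEdges (h : IsRegular B) {c c' : EdgeClass (B * Bᵀ)} {e : E}
    (he : e ∈ h.classEdges c) (he' : e ∈ h.classEdges c') : c = c' := by
  induction c, c' using Quotient.inductionOn₂ with
  | h ε ε' =>
    exact Quotient.sound ((h.vectorSpan_eq_span ε he).trans (h.vectorSpan_eq_span ε' he').symm)

lemma IsRegular.coord_eq_zero_iff_of_mem_classEdges (h : IsRegular B) {c : EdgeClass (B * Bᵀ)}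
    {e f : E} (he : e ∈ h.classEdges c) (hf : f ∈ h.classEdges c) (z : Fin r → ℝ) :
    coord B z e = 0 ↔ coord B z f = 0 :=
  ⟨(h.mem_classEdges_iff he f).mp hf z, (h.mem_classEdges_iff hf e).mp he z⟩

lemma IsRegular.finrank_vectorSpan_eq_one (h : IsRegular B) {e : E} {z : Fin r → ℝ}
    (hz : ∀ f, coord B z f = 0 ↔ ParallelCoords B e f) :
    Module.finrank ℝ (vectorSpan ℝ (dirFace B z)) = 1 := by
  have hker : supportSpace B z = LinearMap.ker (coordFun B e) := by
    ext y
    exact ⟨fun hy => hy e ((hz e).mpr fun _ => id), fun hy f hf => (hz f).mp hf y hy⟩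
  have hsum := h.finrank_vectorSpan_add z
  have hfin := Module.Dual.finrank_ker_add_one_of_ne_zero (h.coordFun_ne_zero e)
  rw [hker] at hsum
  rw [Module.finrank_fin_fun] at hfin
  omega

/-- The edge of the Voronoi cell exposed by a direction whose vanishing coordinates are exactly
those parallel to `e`. -/
noncomputable def IsRegular.voronoiEdge (h : IsRegular B) {e : E} {z : Fin r → ℝ}
    (hz : ∀ f, coord B z f = 0 ↔ ParallelCoords B e f) : VoronoiEdge (B * Bᵀ) :=
  ⟨dirFace B z, (h.isFace_iff _).mpr ⟨z, rfl⟩, h.finrank_vectorSpan_eq_one hz⟩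

lemma IsRegular.mem_classEdges_voronoiEdge (h : IsRegular B) {e : E} {z : Fin r → ℝ}
    (hz : ∀ f, coord B z f = 0 ↔ ParallelCoords B e f) :
    e ∈ h.classEdges (Quotient.mk (parallel _) (h.voronoiEdge hz)) :=
  (h.edgeVec_mem_vectorSpan_iff z e).mpr ((hz e).mpr fun _ => id)

lemma IsRegular.exists_mem_classEdges (h : IsRegular B) (e : E) : ∃ c, e ∈ h.classEdges c := by
  obtain ⟨z, hz⟩ := exists_coord_eq_zero_iff (B := B) e
  exact ⟨_, h.mem_classEdges_voronoiEdge hz⟩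

/-- The parallel class of the edges of the Voronoi cell in the direction of the coordinate `e`. -/
noncomputable def IsRegular.classOf (h : IsRegular B) (e : E) : EdgeClass (B * Bᵀ) :=
  (h.exists_mem_classEdges e).choose

lemma IsRegular.mem_classEdges_iff_classOf (h : IsRegular B) (e : E) (c : EdgeClass (B * Bᵀ)) :
    e ∈ h.classEdges c ↔ h.classOf e = c := by
  have he : e ∈ h.classEdges (h.classOf e) := (h.exists_mem_classEdges e).choose_spec
  exact ⟨h.eq_of_mem_classEdges he, fun hc => hc ▸ he⟩

lemma IsRegular.finite_voronoiEdge (h : IsRegular B) : Finite (VoronoiEdge (B * Bᵀ)) :=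
  (h.finite_isFace.subset fun _ hF => hF.1).to_subtype

lemma IsRegular.finite_edgeClass (h : IsRegular B) : Finite (EdgeClass (B * Bᵀ)) :=
  have := h.finite_voronoiEdge
  inferInstanceAs (Finite (Quotient _))

omit [Fintype E] in
lemma exists_conforms_coord_eq_zero_iff [Finite E] {v : Fin r → ℝ} {e : E}
    (hv : coord B v e = 0) :
    ∃ z, Conforms B v z ∧ ∀ f, coord B z f = 0 ↔ ParallelCoords B e f := by
  obtain ⟨y, hy⟩ := exists_coord_eq_zero_iff (B := B) e
  obtain ⟨ε, hε, hlt⟩ := exists_pos_mul_abs_lt (coord B v) (coord B y)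
  have hconf : Conforms B v (v + ε • y) := by
    intro f hf
    simpa using mul_add_self_pos (hlt f hf)
  refine ⟨_, hconf, fun f => ?_⟩
  by_cases hf : coord B v f = 0
  · simp [hf, hε.ne', hy]
  · exact iff_of_false (fun h0 => hf (hconf.mem_supportSpace f h0)) fun hp => hf (hp v hv)

theorem IsRegular.participates_iff (h : IsRegular B) {c : EdgeClass (B * Bᵀ)} {e : E}
    (he : e ∈ h.classEdges c) (v : Fin r → ℝ) :
    Participates c (dirFace B v) ↔ coord B v e = 0 := by
  constructor
  · rintro ⟨ε, rfl, hε⟩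
    exact (h.edgeVec_mem_vectorSpan_iff v e).mp (vectorSpan_mono ℝ hε he)
  · intro hv
    obtain ⟨z, hconf, hz⟩ := exists_conforms_coord_eq_zero_iff hv
    exact ⟨h.voronoiEdge hz, h.eq_of_mem_classEdges (h.mem_classEdges_voronoiEdge hz) he,
      h.dirFace_anti hconf⟩

lemma IsRegular.not_participates_iff (h : IsRegular B) {v : Fin r → ℤ} (hv : IsSignVector B v)
    {c : EdgeClass (B * Bᵀ)} {e : E} (he : e ∈ h.classEdges c) :
    ¬ Participates c (bisectorFace (B * Bᵀ) v) ↔ (v ᵥ* B) e ≠ 0 := by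
  rw [hv.bisectorFace_eq, h.participates_iff he, coord_toReal, Int.cast_eq_zero]

end EdgeClasses

section FundamentalSystems

variable {E : Type*} {r : ℕ} {B : Matrix (Fin r) E ℤ}

lemma signAgree_toReal_iff {u v : Fin r → ℤ} :
    SignAgree B (toReal u) (toReal v) ↔ ∀ e, 0 ≤ (u ᵥ* B) e * (v ᵥ* B) e := by
  simp only [SignAgree, coord_toReal]
  exact_mod_cast Iff.rfl

lemma mul_nonneg_iff_abs_sub_le_one {a b : ℤ} (ha : |a| ≤ 1) (hb : |b| ≤ 1) :
    0 ≤ a * b ↔ |a - b| ≤ 1 := by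
  rw [abs_le] at *
  obtain rfl | rfl | rfl : a = -1 ∨ a = 0 ∨ a = 1 := by omega
  all_goals omega

lemma IsSignVector.signAgree_iff {u v : Fin r → ℤ} (hu : IsSignVector B u)
    (hv : IsSignVector B v) :
    SignAgree B (toReal u) (toReal v) ↔ IsSignVector B (u - v) := by
  rw [signAgree_toReal_iff]
  refine forall_congr' fun e => ?_
  rw [mul_nonneg_iff_abs_sub_le_one (hu e) (hv e), Matrix.sub_vecMul, Pi.sub_apply]

lemma IsSignVector.neg {v : Fin r → ℤ} (hv : IsSignVector B v) : IsSignVector B (-v) := by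
  intro e
  rw [Matrix.neg_vecMul, Pi.neg_apply, abs_neg]
  exact hv e

lemma IsSignVector.abs_mul_le_one {u v : Fin r → ℤ} (hu : IsSignVector B u)
    (hv : IsSignVector B v) (e : E) : |(u ᵥ* B) e * (v ᵥ* B) e| ≤ 1 :=
  (abs_mul _ _).trans_le (mul_le_one₀ (hu e) (abs_nonneg _) (hv e))

/-- Coordinates `J` that determine every vector, with sign vectors `c j` for `j ∈ J` whose
coordinates in `J` vanish except at `j`. They generalize the edges outside a spanning tree and
their fundamental circuits. -/
structure IsFundamentalSystem (B : Matrix (Fin r) E ℤ) (J : Set E) (c : J → Fin r → ℤ) :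
    Prop where
  eq_zero : ∀ z, (∀ e ∈ J, coord B z e = 0) → z = 0
  sign : ∀ j, IsSignVector B (c j)
  apply_self : ∀ j, (c j ᵥ* B) j = 1
  apply_of_ne : ∀ i j : J, i ≠ j → (c j ᵥ* B) i = 0

lemma IsRegular.exists_isSignVector_eq_one (h : IsRegular B) {J : Set E}
    (hJ : Minimal (fun J : Set E => ∀ z, (∀ e ∈ J, coord B z e = 0) → z = 0) J) (j : J) :
    ∃ c, IsSignVector B c ∧ (c ᵥ* B) j = 1 ∧ ∀ i : J, i ≠ j → (c ᵥ* B) i = 0 := by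
  have hnot : ¬ ∀ z, (∀ e ∈ J \ {j.1}, coord B z e = 0) → z = 0 := fun hcon =>
    (hJ.2 hcon Set.sdiff_subset j.2).2 rfl
  push Not at hnot
  obtain ⟨z, hz, hz0⟩ := hnot
  obtain ⟨u, hu0, hu, huz⟩ := h.conformal z hz0
  have hui (i : J) (hij : i ≠ j) : (u ᵥ* B) i = 0 := by
    have hi := huz.mem_supportSpace i (hz i ⟨i.2, fun h => hij (Subtype.ext h)⟩)
    exact_mod_cast coord_toReal (B := B) u i ▸ hi
  have huj : (u ᵥ* B) j ≠ 0 := by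
    refine fun huj => toReal_ne_zero hu0 (hJ.1 _ fun e he => ?_)
    rw [coord_toReal, Int.cast_eq_zero]
    obtain hej | hej := eq_or_ne ⟨e, he⟩ j
    · rwa [← hej] at huj
    · exact hui ⟨e, he⟩ hej
  obtain hneg | hone : (u ᵥ* B) j = -1 ∨ (u ᵥ* B) j = 1 := by
    have := abs_le.mp (hu j)
    omega
  · refine ⟨-u, hu.neg, ?_, fun i hij => ?_⟩ <;> rw [Matrix.neg_vecMul, Pi.neg_apply]
    · rw [hneg, neg_neg]
    · rw [hui i hij, neg_zero]
  · exact ⟨u, hu, hone, hui⟩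

lemma IsRegular.exists_isFundamentalSystem [Finite E] (h : IsRegular B) :
    ∃ J c, IsFundamentalSystem B J c := by
  obtain ⟨J, hJ⟩ := (Set.toFinite
    {J : Set E | ∀ z, (∀ e ∈ J, coord B z e = 0) → z = 0}).exists_minimal
    ⟨Set.univ, fun z hz => h.inj z (funext fun e => hz e trivial)⟩
  choose c hc using h.exists_isSignVector_eq_one hJ
  exact ⟨J, c, hJ.1, fun j => (hc j).1, fun j => (hc j).2.1, fun i j => (hc j).2.2 i⟩

namespace IsFundamentalSystem

variable {J : Set E} {c : J → Fin r → ℤ}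

lemma ext (hc : IsFundamentalSystem B J c) {u v : Fin r → ℤ}
    (huv : ∀ j : J, (u ᵥ* B) j = (v ᵥ* B) j) : u = v := by
  refine toReal_injective (sub_eq_zero.mp (hc.eq_zero _ fun e he => ?_))
  rw [map_sub, Pi.sub_apply, coord_toReal, coord_toReal, huv ⟨e, he⟩, sub_self]

lemma isElementary (hc : IsFundamentalSystem B J c) (j : J) : IsElementary B (c j) := by
  refine ⟨fun h0 => ?_, hc.sign j, fun y hy => ⟨coord B y j, ?_⟩⟩
  · simpa [h0] using hc.apply_self j
  · refine sub_eq_zero.mp (hc.eq_zero _ fun e he => ?_)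
    rw [map_sub, map_smul, Pi.sub_apply, Pi.smul_apply, smul_eq_mul, coord_toReal]
    obtain rfl | hej := eq_or_ne j ⟨e, he⟩
    · rw [hc.apply_self, Int.cast_one, mul_one, sub_self]
    · have he0 := hc.apply_of_ne ⟨e, he⟩ j hej.symm
      rw [hy e (by rw [coord_toReal, he0, Int.cast_zero]), he0, Int.cast_zero, mul_zero, sub_zero]

lemma isSignVector_sub (hc : IsFundamentalSystem B J c) (h : IsRegular B) {i j : J} (hij : i ≠ j)
    {f : E} (hf : (c i ᵥ* B) f = (c j ᵥ* B) f) (hf0 : (c i ᵥ* B) f ≠ 0) :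
    IsSignVector B (c i - c j) := by
  have hne : c i - c j ≠ 0 := fun h0 => by
    simpa [Matrix.sub_vecMul, hc.apply_self, hc.apply_of_ne i j hij]
      using congrArg (fun v => (v ᵥ* B) i.1) h0
  obtain ⟨u, hu0, hu, huz⟩ := h.conformal _ (toReal_ne_zero hne)
  have hzero (e : E) (he : (c i ᵥ* B) e = (c j ᵥ* B) e) : (u ᵥ* B) e = 0 := by
    simpa [coord_toReal, Matrix.sub_vecMul, he] using huz.mem_supportSpace e
  have hcomb : u = (u ᵥ* B) i • c i + (u ᵥ* B) j • c j := by
    refine hc.ext fun k => ?_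
    simp only [Matrix.add_vecMul, Matrix.smul_vecMul, Pi.add_apply, Pi.smul_apply, smul_eq_mul]
    obtain rfl | hki := eq_or_ne k i
    · rw [hc.apply_self, hc.apply_of_ne k j hij, mul_one, mul_zero, add_zero]
    obtain rfl | hkj := eq_or_ne k j
    · rw [hc.apply_self, hc.apply_of_ne k i hki, mul_one, mul_zero, zero_add]
    · have hi := hc.apply_of_ne k i hki
      have hj := hc.apply_of_ne k j hkj
      rw [hi, hj, hzero k (hi.trans hj.symm), mul_zero, mul_zero, add_zero]
  have hj : (u ᵥ* B) j = -(u ᵥ* B) i := by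
    have hfc := congrArg (fun v => (v ᵥ* B) f) hcomb
    simp only [Matrix.add_vecMul, Matrix.smul_vecMul, Pi.add_apply, Pi.smul_apply, smul_eq_mul,
      hzero f hf, ← hf, ← add_mul] at hfc
    rw [eq_neg_iff_add_eq_zero, add_comm]
    exact (mul_eq_zero.mp hfc.symm).resolve_right hf0
  rw [hj, neg_smul, ← sub_eq_add_neg, ← smul_sub] at hcomb
  have hi : (u ᵥ* B) i ≠ 0 := fun hi => hu0 (by rw [hcomb, hi, zero_smul])
  intro e
  calc |((c i - c j) ᵥ* B) e|
      ≤ |(u ᵥ* B) i| * |((c i - c j) ᵥ* B) e| :=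
        le_mul_of_one_le_left (abs_nonneg _) (Int.one_le_abs hi)
    _ = |(u ᵥ* B) e| := by
        conv_rhs => rw [hcomb]
        rw [Matrix.smul_vecMul, Pi.smul_apply, smul_eq_mul, abs_mul]
    _ ≤ 1 := hu e

lemma signAgree_or_neg (hc : IsFundamentalSystem B J c) (h : IsRegular B) {i j : J}
    (hij : i ≠ j) : SignAgree B (toReal (c i)) (toReal (c j)) ∨
      SignAgree B (toReal (c i)) (toReal (-c j)) := by
  refine or_iff_not_imp_right.mpr fun hneg => ?_
  simp only [signAgree_toReal_iff, Matrix.neg_vecMul, Pi.neg_apply, mul_neg, not_forall,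
    not_le, neg_neg_iff_pos] at hneg
  obtain ⟨f, hf⟩ := hneg
  rw [(hc.sign i).signAgree_iff (hc.sign j)]
  have hi := abs_le.mp (hc.sign i f)
  have hj := abs_le.mp (hc.sign j f)
  refine hc.isSignVector_sub h hij (f := f) ?_ (left_ne_zero_of_mul hf.ne')
  obtain ⟨h₁, h₂⟩ | ⟨h₁, h₂⟩ := pos_and_pos_or_neg_and_neg_of_mul_pos hf <;> omega

lemma vecMul_sum_smul [Fintype J] (hc : IsFundamentalSystem B J c) (a : J → ℤ) (i : J) :
    ((∑ j, a j • c j) ᵥ* B) i = a i := by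
  rw [Matrix.sum_vecMul, Finset.sum_apply, Fintype.sum_eq_single i, Matrix.smul_vecMul,
    Pi.smul_apply, hc.apply_self, smul_eq_mul, mul_one]
  intro j hj
  rw [Matrix.smul_vecMul, Pi.smul_apply, hc.apply_of_ne i j hj.symm, smul_zero]

variable [Finite E]

lemma linearIndependent (hc : IsFundamentalSystem B J c) : LinearIndependent ℤ c := by
  have := Fintype.ofFinite J
  refine Fintype.linearIndependent_iff.mpr fun a ha i => ?_
  rw [← hc.vecMul_sum_smul a i, ha, Matrix.zero_vecMul, Pi.zero_apply]

lemma span_eq_top (hc : IsFundamentalSystem B J c) :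
    Submodule.span ℤ (Set.range c) = ⊤ := by
  have := Fintype.ofFinite J
  refine eq_top_iff.mpr fun v _ => ?_
  rw [show v = ∑ j : J, (v ᵥ* B) j • c j from
    hc.ext fun i => (hc.vecMul_sum_smul (fun j => (v ᵥ* B) j) i).symm]
  exact sum_mem fun j _ => Submodule.smul_mem _ _ (Submodule.subset_span ⟨j, rfl⟩)

lemma card_eq (hc : IsFundamentalSystem B J c) : Nat.card J = r := by
  rw [← Module.finrank_eq_nat_card_basis
    (Module.Basis.mk hc.linearIndependent hc.span_eq_top.ge), Module.finrank_fin_fun]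

end IsFundamentalSystem

end FundamentalSystems

section GoodBases

variable {E : Type*} {r : ℕ} [Fintype E] {B : Matrix (Fin r) E ℤ}

lemma IsRegular.bisectorFace_inter_nonempty_iff (h : IsRegular B) {u v : Fin r → ℤ}
    (hu : IsSignVector B u) (hv : IsSignVector B v) :
    (bisectorFace (B * Bᵀ) u ∩ bisectorFace (B * Bᵀ) v).Nonempty ↔
      SignAgree B (toReal u) (toReal v) := by
  rw [hu.bisectorFace_eq, hv.bisectorFace_eq, h.dirFace_inter_nonempty_iff]

theorem IsRegular.exists_isGoodBasis (h : IsRegular B) : ∃ C, IsGoodBasis (B * Bᵀ) C := by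
  obtain ⟨J, c, hc⟩ := h.exists_isFundamentalSystem
  let σ : Fin r ≃ J := (Finite.equivFinOfCardEq hc.card_eq).symm
  refine ⟨c ∘ σ, hc.linearIndependent.comp _ σ.injective, ?_,
    fun i => h.isFacet_of_isElementary (hc.isElementary _), fun i j hij => ?_⟩
  · rw [σ.surjective.range_comp, hc.span_eq_top]
  · simp only [Function.comp_apply, h.bisectorFace_inter_nonempty_iff (hc.sign _) (hc.sign _),
      h.bisectorFace_inter_nonempty_iff (hc.sign _) (hc.sign _).neg]
    exact hc.signAgree_or_neg h (σ.injective.ne hij)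

variable {C : Fin r → (Fin r → ℤ)}

lemma IsRegular.isElementary_of_isGoodBasis (h : IsRegular B) (hC : IsGoodBasis (B * Bᵀ) C)
    (i : Fin r) : IsElementary B (C i) :=
  (h.isFacet_bisectorFace_iff _).mp (hC.isFacet i)

lemma IsRegular.exists_eq_mul_abs_of_isGoodBasis (h : IsRegular B) (hC : IsGoodBasis (B * Bᵀ) C)
    (i j : Fin r) : ∃ s : ℤ, |s| = 1 ∧
      ∀ e, (C i ᵥ* B) e * (C j ᵥ* B) e = s * |(C i ᵥ* B) e * (C j ᵥ* B) e| := by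
  have hs (i) : IsSignVector B (C i) := (h.isElementary_of_isGoodBasis hC i).sign
  have hagree : SignAgree B (toReal (C i)) (toReal (C j)) ∨
      SignAgree B (toReal (C i)) (toReal (-C j)) := by
    obtain rfl | hij := eq_or_ne i j
    · exact Or.inl fun e => mul_self_nonneg _
    · rw [← h.bisectorFace_inter_nonempty_iff (hs i) (hs j),
        ← h.bisectorFace_inter_nonempty_iff (hs i) (hs j).neg]
      exact hC.meets i j hij
  simp only [signAgree_toReal_iff, Matrix.neg_vecMul, Pi.neg_apply, mul_neg,
    neg_nonneg] at hagree
  obtain hpos | hneg := hagree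
  · exact ⟨1, abs_one, fun e => by rw [abs_of_nonneg (hpos e), one_mul]⟩
  · exact ⟨-1, by simp, fun e => by rw [abs_of_nonpos (hneg e), neg_one_mul, neg_neg]⟩

theorem IsRegular.abs_latticeForm_of_isGoodBasis (h : IsRegular B)
    (hC : IsGoodBasis (B * Bᵀ) C) (i j : Fin r) :
    |latticeForm (B * Bᵀ) (C i) (C j)| = ∑ e, |(C i ᵥ* B) e * (C j ᵥ* B) e| := by
  obtain ⟨s, hs, he⟩ := h.exists_eq_mul_abs_of_isGoodBasis hC i j
  rw [latticeForm_mul_transpose, Finset.sum_congr rfl fun e _ => he e, ← Finset.mul_sum, abs_mul,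
    hs, one_mul, Finset.abs_sum_of_nonneg' fun e => abs_nonneg _]

end GoodBases

section LinearSystem

variable {E : Type*} {r : ℕ} [Fintype E] {B : Matrix (Fin r) E ℤ} {C : Fin r → (Fin r → ℤ)}

/-- A chosen coordinate in the class `c`. -/
noncomputable def IsRegular.rep (h : IsRegular B) (c : EdgeClass (B * Bᵀ)) : E :=
  (h.classEdges_nonempty c).some

lemma IsRegular.rep_mem (h : IsRegular B) (c : EdgeClass (B * Bᵀ)) : h.rep c ∈ h.classEdges c :=
  (h.classEdges_nonempty c).some_mem

lemma abs_eq_ite_of_abs_le_one {a : ℤ} (ha : |a| ≤ 1) : |a| = if a = 0 then 0 else 1 := by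
  split_ifs with h0
  · rw [h0, abs_zero]
  · exact ha.antisymm (Int.one_le_abs h0)

lemma IsRegular.abs_mul_eq_of_mem_classEdges (h : IsRegular B) {u v : Fin r → ℤ}
    (hu : IsSignVector B u) (hv : IsSignVector B v) {c : EdgeClass (B * Bᵀ)} {e f : E}
    (he : e ∈ h.classEdges c) (hf : f ∈ h.classEdges c) :
    |(u ᵥ* B) e * (v ᵥ* B) e| = |(u ᵥ* B) f * (v ᵥ* B) f| := by
  have hiff (w : Fin r → ℤ) : (w ᵥ* B) e = 0 ↔ (w ᵥ* B) f = 0 := by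
    simpa [coord_toReal] using h.coord_eq_zero_iff_of_mem_classEdges he hf (toReal w)
  simp only [abs_eq_ite_of_abs_le_one (hu.abs_mul_le_one hv _), mul_eq_zero, hiff]

variable [Fintype (EdgeClass (B * Bᵀ))]

lemma IsRegular.finsum_not_participates (h : IsRegular B) {u v : Fin r → ℤ}
    (hu : IsSignVector B u) (hv : IsSignVector B v) (n : EdgeClass (B * Bᵀ) → ℕ) :
    ((∑ᶠ c ∈ {c | ¬ Participates c (bisectorFace (B * Bᵀ) u) ∧
        ¬ Participates c (bisectorFace (B * Bᵀ) v)}, n c : ℕ) : ℤ) =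
      ∑ c, n c * |(u ᵥ* B) (h.rep c) * (v ᵥ* B) (h.rep c)| := by
  classical
  rw [finsum_mem_def, finsum_eq_sum_of_fintype, Nat.cast_sum]
  refine Finset.sum_congr rfl fun c _ => ?_
  simp only [Set.indicator_apply, Set.mem_ofPred_eq, h.not_participates_iff hu (h.rep_mem c),
    h.not_participates_iff hv (h.rep_mem c), ← mul_ne_zero_iff,
    abs_eq_ite_of_abs_le_one (hu.abs_mul_le_one hv _)]
  split_ifs <;> simp_all

theorem IsRegular.isSolution_iff (h : IsRegular B) (hC : IsGoodBasis (B * Bᵀ) C)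
    (n : EdgeClass (B * Bᵀ) → ℕ) :
    IsSolution (B * Bᵀ) C n ↔ (∀ c, 0 < n c) ∧ ∀ i j,
      ∑ c, n c * |(C i ᵥ* B) (h.rep c) * (C j ᵥ* B) (h.rep c)| =
        |latticeForm (B * Bᵀ) (C i) (C j)| := by
  have hs (i) : IsSignVector B (C i) := (h.isElementary_of_isGoodBasis hC i).sign
  have hself (i) : |latticeForm (B * Bᵀ) (C i) (C i)| = latticeForm (B * Bᵀ) (C i) (C i) := by
    rw [latticeForm_mul_transpose, Finset.abs_sum_of_nonneg' fun e => mul_self_nonneg _]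
  simp only [← h.finsum_not_participates (hs _) (hs _)]
  refine ⟨fun hn => ⟨hn.pos, fun i j => ?_⟩, fun hn => ⟨hn.1, fun i => ?_, fun i j _ => hn.2 i j⟩⟩
  · obtain rfl | hij := eq_or_ne i j
    · simpa only [and_self, hself] using hn.length i
    · exact hn.intersect i j hij
  · simpa only [and_self, hself] using hn.2 i i

lemma IsRegular.sum_eq_sum_ncard_mul (h : IsRegular B) {g : E → ℤ}
    (hg : ∀ c, ∀ e ∈ h.classEdges c, g e = g (h.rep c)) :
    ∑ e, g e = ∑ c, ((h.classEdges c).ncard : ℤ) * g (h.rep c) := by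
  classical
  rw [← Finset.sum_fiberwise _ h.classOf]
  refine Finset.sum_congr rfl fun c _ => ?_
  have hmem (e) : e ∈ ({e | h.classOf e = c} : Finset E) ↔ e ∈ h.classEdges c := by
    rw [h.mem_classEdges_iff_classOf, Finset.mem_filter_univ]
  rw [Finset.sum_congr rfl fun e he => hg c e ((hmem e).mp he), Finset.sum_const, nsmul_eq_mul,
    ← Set.ncard_coe_finset, Set.ext hmem]

end LinearSystem

section Uniqueness

lemma sum_mul_mul_eq_zero_of_basis {R M ι κ : Type*} [CommRing R] [AddCommGroup M] [Module R M]
    [Fintype κ] (b : Module.Basis ι R M) (φ : κ → Module.Dual R M) {d : κ → R}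
    (hb : ∀ i j, ∑ c, d c * (φ c (b i) * φ c (b j)) = 0) (u v : M) :
    ∑ c, d c * (φ c u * φ c v) = 0 := by
  have happly (u v : M) : (∑ c, d c • LinearMap.BilinForm.linMulLin (φ c) (φ c)) u v =
      ∑ c, d c * (φ c u * φ c v) := by
    simp [LinearMap.sum_apply]
  rw [← happly, LinearMap.BilinForm.ext_basis b (F₂ := 0) fun i j => (happly _ _).trans (hb i j)]
  rfl

variable {E : Type*} {r : ℕ} [Fintype E] {B : Matrix (Fin r) E ℤ} {C : Fin r → (Fin r → ℤ)}

theorem IsRegular.isSolution_ncard (h : IsRegular B) (hC : IsGoodBasis (B * Bᵀ) C) :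
    IsSolution (B * Bᵀ) C fun c => (h.classEdges c).ncard := by
  have := h.finite_edgeClass
  have := Fintype.ofFinite (EdgeClass (B * Bᵀ))
  have hs (i) : IsSignVector B (C i) := (h.isElementary_of_isGoodBasis hC i).sign
  refine (h.isSolution_iff hC _).mpr
    ⟨fun c => (Set.ncard_pos (Set.toFinite _)).mpr (h.classEdges_nonempty c), fun i j => ?_⟩
  rw [h.abs_latticeForm_of_isGoodBasis hC, h.sum_eq_sum_ncard_mul fun c e he =>
    h.abs_mul_eq_of_mem_classEdges (hs i) (hs j) he (h.rep_mem c)]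

lemma IsRegular.linearIndependent_abs_coordFun_rep (h : IsRegular B) :
    LinearIndependent ℝ fun c z => |coordFun B (h.rep c) z| := by
  have := h.finite_edgeClass
  refine linearIndependent_abs (fun c => h.coordFun_ne_zero _) fun c c' hcc' => ?_
  by_contra! hpar
  exact hcc' (h.eq_of_mem_classEdges ((h.mem_classEdges_iff (h.rep_mem c) _).mpr hpar)
    (h.rep_mem c'))

omit [Fintype E] in
lemma IsRegular.sum_mul_abs_coord_eq_zero [Finite E] {κ : Type*} [Fintype κ] (h : IsRegular B)
    {d : κ → ℝ} {e : κ → E} (hd : ∀ u, IsSignVector B u → ∑ c, d c * |coord B (toReal u) (e c)| = 0)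
    (z : Fin r → ℝ) : ∑ c, d c * |coord B z (e c)| = 0 := by
  induction z using h.induction with
  | zero => simp
  | add u t z hu ht huz hz =>
    simp only [huz.abs_coord_add_smul ht.le, mul_add, Finset.sum_add_distrib, hz, zero_add,
      mul_left_comm _ t, ← Finset.mul_sum, hd u hu, mul_zero]

theorem IsRegular.isSolution_unique (h : IsRegular B) (hC : IsGoodBasis (B * Bᵀ) C)
    {n n' : EdgeClass (B * Bᵀ) → ℕ} (hn : IsSolution (B * Bᵀ) C n)
    (hn' : IsSolution (B * Bᵀ) C n') : n = n' := by
  have := h.finite_edgeClass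
  have := Fintype.ofFinite (EdgeClass (B * Bᵀ))
  rw [h.isSolution_iff hC] at hn hn'
  let x (c : EdgeClass (B * Bᵀ)) : Module.Dual ℤ (Fin r → ℤ) :=
    LinearMap.proj (h.rep c) ∘ₗ Matrix.vecMulLinear B
  have hbasis (i j : Fin r) : ∑ c, ((n c : ℤ) - n' c) * (x c (C i) * x c (C j)) = 0 := by
    obtain ⟨s, -, hs⟩ := h.exists_eq_mul_abs_of_isGoodBasis hC i j
    have hx (c) : x c (C i) * x c (C j) = s * |x c (C i) * x c (C j)| := hs _
    have heq : ∑ c, (n c : ℤ) * |x c (C i) * x c (C j)| =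
        ∑ c, (n' c : ℤ) * |x c (C i) * x c (C j)| :=
      (hn.2 i j).trans (hn'.2 i j).symm
    calc ∑ c, ((n c : ℤ) - n' c) * (x c (C i) * x c (C j))
        = ∑ c, s * (n c * |x c (C i) * x c (C j)| - n' c * |x c (C i) * x c (C j)|) :=
          Finset.sum_congr rfl fun c _ => by
            linear_combination ((n c : ℤ) - n' c) * hx c
      _ = 0 := by rw [← Finset.mul_sum, Finset.sum_sub_distrib, heq, sub_self, mul_zero]
  have hform := sum_mul_mul_eq_zero_of_basis
    (Module.Basis.mk hC.linearIndependent hC.span_eq_top.ge) x (by simpa using hbasis)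
  have hsign (u) (hu : IsSignVector B u) :
      ∑ c, ((n c : ℝ) - n' c) * |coord B (toReal u) (h.rep c)| = 0 := by
    have huu := hform u u
    have hx (c) : x c u * x c u = |(u ᵥ* B) (h.rep c)| := mul_self_eq_abs_of_abs_le_one (hu _)
    simp only [hx] at huu
    simp only [coord_toReal]
    exact_mod_cast huu
  funext c
  have hzero := Fintype.linearIndependent_iff.mp h.linearIndependent_abs_coordFun_rep
    (fun c => (n c : ℝ) - n' c)
    (by ext z; simpa [coordFun] using h.sum_mul_abs_coord_eq_zero hsign z) c
  exact_mod_cast sub_eq_zero.mp hzero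

end Uniqueness

section Circulations

variable {E α R : Type*} {tail head : E → α}

section

variable [Fintype E] [CommRing R]

/-- The net inflow of `f` at each vertex. -/
noncomputable def boundary (R : Type*) [CommRing R] (tail head : E → α) : (E → R) →ₗ[R] (α →₀ R) :=
  Fintype.linearCombination R fun e => Finsupp.single (head e) 1 - Finsupp.single (tail e) 1

/-- The net inflow vanishes at every vertex. -/
def IsCirculation (tail head : E → α) (f : E → R) : Prop := boundary R tail head f = 0

lemma boundary_apply (f : E → R) : boundary R tail head f =
    ∑ e, f e • (Finsupp.single (head e) 1 - Finsupp.single (tail e) 1) := rfl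

lemma boundary_single [DecidableEq E] (e : E) (a : R) : boundary R tail head (Pi.single e a) =
    a • (Finsupp.single (head e) 1 - Finsupp.single (tail e) 1) :=
  Fintype.linearCombination_apply_single _ _ _ _

lemma boundary_apply_apply [DecidableEq α] (f : E → R) (x : α) :
    boundary R tail head f x = ∑ e with head e = x, f e - ∑ e with tail e = x, f e := by
  classical
  simp [boundary_apply, Finsupp.finsetSum_apply, Finsupp.single_apply, mul_sub,
    Finset.sum_filter]

lemma IsCirculation.intCast {a : E → ℤ} (ha : IsCirculation tail head a) :
    IsCirculation tail head (fun e => (a e : ℝ)) := by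
  classical
  ext x
  have hx : boundary ℤ tail head a x = 0 := DFunLike.congr_fun ha x
  rw [boundary_apply_apply] at hx ⊢
  rw [Finsupp.zero_apply]
  exact_mod_cast hx

lemma IsCirculation.sum_mul_sub {f : E → R} (hf : IsCirculation tail head f) (p : α → R) :
    ∑ e, f e * (p (head e) - p (tail e)) = 0 := by
  have hp := congrArg (Finsupp.linearCombination R p) hf
  simpa [boundary_apply] using hp

end

section Cycles

lemma exists_iterate_mem_periodicPts {X : Type*} [Finite X] (step : X → X) (x : X) :
    ∃ n, step^[n] x ∈ Function.periodicPts step := by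
  obtain ⟨m, n, hne, heq⟩ := Finite.exists_ne_map_eq_of_infinite fun n : ℕ => step^[n] x
  wlog hlt : m < n generalizing m n
  · exact this n m hne.symm heq.symm (by omega)
  refine ⟨m, Function.mk_mem_periodicPts (Nat.sub_pos_of_lt hlt) ?_⟩
  rw [Function.IsPeriodicPt, Function.IsFixedPt, ← Function.iterate_add_apply,
    Nat.sub_add_cancel hlt.le]
  exact heq.symm

lemma exists_injective_cycle {X : Type*} [Finite X] [Nonempty X] (step : X → X) :
    ∃ (k : ℕ) (w : Fin (k + 1) → X), w.Injective ∧ ∀ i, w (i + 1) = step (w i) := by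
  obtain ⟨n, hn⟩ := exists_iterate_mem_periodicPts step (Classical.arbitrary X)
  set x := step^[n] (Classical.arbitrary X)
  obtain ⟨k, hk⟩ := Nat.exists_eq_succ_of_ne_zero
    (Function.minimalPeriod_pos_of_mem_periodicPts hn).ne'
  refine ⟨k, fun i => step^[i] x, fun i j hij => Fin.ext ?_, fun i => ?_⟩
  · exact Function.iterate_injOn_Iio_minimalPeriod (hk ▸ i.2) (hk ▸ j.2) hij
  · change step^[(i + 1 : Fin (k + 1))] x = step (step^[i] x)
    rw [← Function.iterate_succ_apply' step,
      ← Function.iterate_mod_minimalPeriod_eq (n := i.1.succ), hk, Fin.val_add,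
      Fin.val_one', Nat.add_mod_mod]

variable [Fintype E]

lemma IsCirculation.exists_pos_of_pos {f : E → ℝ} (hf : IsCirculation tail head f)
    (hnn : 0 ≤ f) {e : E} (he : 0 < f e) : ∃ e', 0 < f e' ∧ tail e' = head e := by
  classical
  by_contra! hcon
  have hout : ∑ d with tail d = head e, f d = 0 := Finset.sum_eq_zero fun d hd =>
    ((hnn d).lt_or_eq.resolve_left fun hpos => hcon d hpos (Finset.mem_filter.mp hd).2).symm
  have hin : 0 < ∑ d with head d = head e, f d :=
    Finset.sum_pos' (fun d _ => hnn d) ⟨e, by simp, he⟩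
  have hbal : boundary ℝ tail head f (head e) = 0 := DFunLike.congr_fun hf _
  rw [boundary_apply_apply] at hbal
  linarith

lemma IsCirculation.exists_directed_cycle {f : E → ℝ} (hf : IsCirculation tail head f)
    (hnn : 0 ≤ f) (hf0 : f ≠ 0) :
    ∃ (k : ℕ) (e : Fin (k + 1) → E), (tail ∘ e).Injective ∧
      (∀ i, head (e i) = tail (e (i + 1))) ∧ ∀ i, 0 < f (e i) := by
  obtain ⟨e₀, he₀⟩ := Function.ne_iff.mp hf0
  let X := {x : α // ∃ e, 0 < f e ∧ tail e = x}
  have : Nonempty X := ⟨⟨tail e₀, e₀, (hnn e₀).lt_of_ne' he₀, rfl⟩⟩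
  have : Finite X := ((Set.finite_range tail).subset
    (by rintro _ ⟨e, -, rfl⟩; exact ⟨e, rfl⟩)).to_subtype
  choose out hpos htail using fun x : X => x.2
  let step (x : X) : X := ⟨head (out x), hf.exists_pos_of_pos hnn (hpos x)⟩
  obtain ⟨k, w, hw, hstep⟩ := exists_injective_cycle step
  refine ⟨k, out ∘ w, fun i j hij => hw (Subtype.ext ?_), fun i => ?_, fun i => hpos (w i)⟩
  · simpa only [Function.comp_apply, htail] using hij
  · rw [Function.comp_apply, Function.comp_apply, htail, hstep]

end Cycles

section SignedWalks

/-- A closed walk with signs recording the direction of traversal. -/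
def IsSignedWalk (tail head : E → α) (k : ℕ) (v : Fin (k + 1) → α) (e : Fin (k + 1) → E)
    (s : Fin (k + 1) → ℤ) : Prop :=
  ∀ i, (s i = 1 ∧ tail (e i) = v i ∧ head (e i) = v (i + 1)) ∨
    (s i = -1 ∧ head (e i) = v i ∧ tail (e i) = v (i + 1))

open Classical in
/-- The signed sum of the edges of a walk. -/
noncomputable def walkVec {k : ℕ} (e : Fin (k + 1) → E) (s : Fin (k + 1) → ℤ) : E → ℤ :=
  ∑ i, Pi.single (e i) (s i)

theorem IsCirculation.exists_signedWalk [Fintype E] {f : E → ℝ} (hf : IsCirculation tail head f)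
    (hf0 : f ≠ 0) :
    ∃ (k : ℕ) (v : Fin (k + 1) → α) (e : Fin (k + 1) → E) (s : Fin (k + 1) → ℤ),
      v.Injective ∧ e.Injective ∧ IsSignedWalk tail head k v e s ∧
      ∀ i, 0 < (s i : ℝ) * f (e i) := by
  classical
  let source (e : E) : α := if 0 < f e then tail e else head e
  let target (e : E) : α := if 0 < f e then head e else tail e
  -- Reversing the edges on which `f` is negative makes it a nonnegative circulation.
  have habs : IsCirculation source target fun e => |f e| := by
    refine Eq.trans (Finset.sum_congr rfl fun e _ => ?_) hf
    by_cases he : 0 < f e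
    · simp only [source, target, if_pos he, abs_of_pos he]
    · simp only [source, target, if_neg he, abs_of_nonpos (not_lt.mp he), neg_smul, ← smul_neg,
        neg_sub]
  obtain ⟨k, e, hinj, hnext, hpos⟩ := habs.exists_directed_cycle (fun _ => abs_nonneg _)
    fun h0 => hf0 (funext fun e => abs_eq_zero.mp (congrFun h0 e))
  refine ⟨k, source ∘ e, e, fun i => if 0 < f (e i) then 1 else -1, hinj, hinj.of_comp,
    fun i => ?_, fun i => ?_⟩
  · have hi := hnext i
    by_cases he : 0 < f (e i)
    · exact Or.inl ⟨if_pos he, (if_pos he).symm, (if_pos he).symm.trans hi⟩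
    · exact Or.inr ⟨if_neg he, (if_neg he).symm, (if_neg he).symm.trans hi⟩
  · by_cases he : 0 < f (e i)
    · simp [he]
    · simpa [he] using (not_lt.mp he).lt_of_ne (abs_pos.mp (hpos i))

variable {k : ℕ} {v : Fin (k + 1) → α} {e : Fin (k + 1) → E} {s : Fin (k + 1) → ℤ}

lemma walkVec_apply (he : e.Injective) (i : Fin (k + 1)) : walkVec e s (e i) = s i := by
  simp [walkVec, Pi.single_apply, he.eq_iff]

lemma walkVec_of_notMem {d : E} (hd : d ∉ Set.range e) : walkVec e s d = 0 := by
  classical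
  rw [walkVec, Finset.sum_apply]
  exact Finset.sum_eq_zero fun j _ => Pi.single_eq_of_ne (fun h => hd ⟨j, h.symm⟩) _

namespace IsSignedWalk

lemma mul_self_eq_one (h : IsSignedWalk tail head k v e s) (i : Fin (k + 1)) : s i * s i = 1 := by
  rcases h i with ⟨hs, -⟩ | ⟨hs, -⟩ <;> simp [hs]

lemma abs_walkVec_le (h : IsSignedWalk tail head k v e s) (he : e.Injective) (d : E) :
    |walkVec e s d| ≤ 1 := by
  by_cases hd : d ∈ Set.range e
  · obtain ⟨i, rfl⟩ := hd
    rw [walkVec_apply he]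
    rcases h i with ⟨hs, -⟩ | ⟨hs, -⟩ <;> simp [hs]
  · simp [walkVec_of_notMem hd]

lemma walkVec_ne_zero_iff (h : IsSignedWalk tail head k v e s) (he : e.Injective) (d : E) :
    walkVec e s d ≠ 0 ↔ d ∈ Set.range e := by
  refine ⟨fun hd => by_contra fun hcon => hd (walkVec_of_notMem hcon), ?_⟩
  rintro ⟨i, rfl⟩
  rw [walkVec_apply he]
  rcases h i with ⟨hs, -⟩ | ⟨hs, -⟩ <;> simp [hs]

lemma single_sub_single [Ring R] (h : IsSignedWalk tail head k v e s) (i : Fin (k + 1)) :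
    (Finsupp.single (head (e i)) 1 - Finsupp.single (tail (e i)) 1 : α →₀ R) =
      s i • (Finsupp.single (v (i + 1)) 1 - Finsupp.single (v i) 1) := by
  rcases h i with ⟨hs, h1, h2⟩ | ⟨hs, h1, h2⟩ <;> simp [hs, h1, h2]

variable [Fintype E]

lemma isCirculation (h : IsSignedWalk tail head k v e s) :
    IsCirculation tail head (walkVec e s) := by
  classical
  have hstep (i) : boundary ℤ tail head (Pi.single (e i) (s i)) =
      Finsupp.single (v (i + 1)) 1 - Finsupp.single (v i) 1 := by
    rw [boundary_single, h.single_sub_single, smul_smul, h.mul_self_eq_one, one_smul]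
  rw [IsCirculation, walkVec, map_sum, Finset.sum_congr rfl fun i _ => hstep i,
    Finset.sum_sub_distrib, sub_eq_zero]
  exact Equiv.sum_comp (Equiv.addRight 1) fun i => Finsupp.single (v i) 1

lemma mul_apply_eq (h : IsSignedWalk tail head k v e s) (hv : v.Injective) (he : e.Injective)
    {y : E → ℝ} (hy : IsCirculation tail head y) (hsupp : ∀ d ∉ Set.range e, y d = 0)
    (j : Fin (k + 1)) : s (j + 1) * y (e (j + 1)) = s j * y (e j) := by
  classical
  have hsum : ∑ i, (s i * y (e i)) •
      (Finsupp.single (v (i + 1)) 1 - Finsupp.single (v i) 1 : α →₀ ℝ) = 0 := by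
    rw [← hy, boundary_apply, ← Finset.sum_subset (Finset.subset_univ (Finset.univ.image e)),
      Finset.sum_image fun i _ j _ hij => he hij]
    · refine Finset.sum_congr rfl fun i _ => ?_
      rw [h.single_sub_single, mul_comm, mul_smul, ← Int.cast_smul_eq_zsmul ℝ (s i)]
    · intro d _ hd
      rw [hsupp d (by simpa using hd), zero_smul]
  have hj := DFunLike.congr_fun hsum (v (j + 1))
  simp only [Finsupp.finsetSum_apply, Finsupp.smul_apply, Finsupp.sub_apply, Finsupp.single_apply,
    hv.eq_iff, add_left_inj, mul_sub, smul_eq_mul, Finset.sum_sub_distrib, mul_ite, mul_one,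
    mul_zero, Finset.sum_ite_eq', Finset.mem_univ, if_true, Finsupp.zero_apply] at hj
  linarith

theorem exists_eq_mul_walkVec (h : IsSignedWalk tail head k v e s) (hv : v.Injective)
    (he : e.Injective) {y : E → ℝ} (hy : IsCirculation tail head y)
    (hsupp : ∀ d ∉ Set.range e, y d = 0) : ∃ t : ℝ, ∀ d, y d = t * walkVec e s d := by
  have hconst (j : Fin (k + 1)) : s j * y (e j) = s 0 * y (e 0) := by
    induction j using Fin.induction with
    | zero => rfl
    | succ i ih => rw [← Fin.coeSucc_eq_succ, h.mul_apply_eq hv he hy hsupp, ih]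
  refine ⟨s 0 * y (e 0), fun d => ?_⟩
  by_cases hd : d ∈ Set.range e
  · obtain ⟨i, rfl⟩ := hd
    have hone : (s i : ℝ) * s i = 1 := mod_cast h.mul_self_eq_one i
    rw [walkVec_apply he, ← hconst i]
    linear_combination (-y (e i)) * hone
  · rw [walkVec_of_notMem hd, hsupp d hd, Int.cast_zero, mul_zero]

end IsSignedWalk

end SignedWalks

end Circulations

section CirculationLattice

variable {E α : Type*} [Fintype E] {tail head : E → α} {r : ℕ} {B : Matrix (Fin r) E ℤ}

lemma isCirculation_coord (hB : ∀ i, IsCirculation tail head (B i)) (z : Fin r → ℝ) :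
    IsCirculation tail head (coord B z) := by
  have hz : coord B z = ∑ i, z i • fun e => (B i e : ℝ) := by
    ext e
    simp [coord_apply]
  rw [hz, IsCirculation, map_sum]
  refine Finset.sum_eq_zero fun i _ => ?_
  rw [map_smul, (hB i).intCast, smul_zero]

omit [Fintype E] in
lemma eq_zero_of_coord_eq_zero [Finite E] (h : ∀ u : Fin r → ℤ, u ᵥ* B = 0 → u = 0)
    {z : Fin r → ℝ} (hz : coord B z = 0) : z = 0 := by
  have := Fintype.ofFinite E
  have hdet : (B * Bᵀ).det ≠ 0 := by
    intro h0
    obtain ⟨u, hu0, hu⟩ := Matrix.exists_vecMul_eq_zero_iff.mpr h0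
    rw [← Matrix.conjTranspose_eq_transpose_of_trivial,
      Matrix.vecMul_self_mul_conjTranspose_eq_zero] at hu
    exact hu0 (h u hu)
  have hdet' : ((B * Bᵀ).map (Int.castRingHom ℝ)).det ≠ 0 := by
    rw [← RingHom.mapMatrix_apply, ← RingHom.map_det]
    exact Int.cast_ne_zero.mpr hdet
  refine Matrix.eq_zero_of_vecMul_eq_zero hdet' ?_
  rw [Matrix.map_mul, ← Matrix.vecMul_vecMul]
  exact (congrArg (· ᵥ* _) hz).trans (Matrix.zero_vecMul _)

theorem isRegular_of_circulations (hinj : ∀ u : Fin r → ℤ, u ᵥ* B = 0 → u = 0)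
    (hB : ∀ i, IsCirculation tail head (B i))
    (hgen : ∀ a : E → ℤ, IsCirculation tail head a → ∃ u, u ᵥ* B = a)
    (hcol : ∀ e, ∃ i, B i e ≠ 0) : IsRegular B where
  inj _ := eq_zero_of_coord_eq_zero hinj
  conformal z hz := by
    obtain ⟨k, v, e, s, -, he, hw, hpos⟩ := (isCirculation_coord hB z).exists_signedWalk
      (mt (eq_zero_of_coord_eq_zero hinj) hz)
    obtain ⟨u, hu⟩ := hgen _ hw.isCirculation
    refine ⟨u, ?_, fun d => by rw [hu]; exact hw.abs_walkVec_le he d, fun d hd => ?_⟩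
    · rintro rfl
      refine (hw.walkVec_ne_zero_iff he (e 0)).mpr ⟨0, rfl⟩ ?_
      rw [← hu, Matrix.zero_vecMul, Pi.zero_apply]
    · rw [coord_toReal, hu] at hd ⊢
      obtain ⟨i, rfl⟩ := (hw.walkVec_ne_zero_iff he d).mp (mod_cast hd)
      rw [walkVec_apply he]
      exact hpos i
  col_ne := hcol

end CirculationLattice

lemma eq_of_abs_le_one_of_mul_pos {a b : ℤ} (ha : |a| ≤ 1) (hb : |b| ≤ 1) (hab : 0 < a * b) :
    a = b := by
  obtain ⟨ha₁, ha₂⟩ := abs_le.mp ha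
  obtain ⟨hb₁, hb₂⟩ := abs_le.mp hb
  interval_cases a <;> interval_cases b <;> simp_all

lemma IsElementary.eq_of_conforms {E : Type*} {r : ℕ} {B : Matrix (Fin r) E ℤ} {u v : Fin r → ℤ}
    (hv : IsElementary B v) (hu : IsSignVector B u) {e : E} (he : (u ᵥ* B) e ≠ 0)
    (huv : Conforms B (toReal u) (toReal v)) : u = v := by
  obtain ⟨t, ht⟩ := hv.eq_smul _ huv.mem_supportSpace
  have hpos := huv e (by rwa [coord_toReal, Int.cast_ne_zero])
  rw [coord_toReal, coord_toReal] at hpos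
  have heq : (u ᵥ* B) e = (v ᵥ* B) e :=
    eq_of_abs_le_one_of_mul_pos (hu e) (hv.sign e) (mod_cast hpos)
  have hte : coord B (toReal u) e = t * coord B (toReal v) e := by rw [ht]; simp
  rw [coord_toReal, coord_toReal, ← heq] at hte
  have ht1 : t = 1 := mul_right_cancel₀ (Int.cast_ne_zero.mpr he) (hte.symm.trans (one_mul _).symm)
  exact toReal_injective (by rw [ht, ht1, one_smul])

section FlowMatrix

variable {α β : Type*} {G : Graph α β} [Fintype E(G)] {o : Orientation G} {r : ℕ}

lemma mem_flowLattice_iff (a : E(G) → ℤ) :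
    a ∈ flowLattice o ↔ IsCirculation o.tail o.head a := by
  classical
  have hiff : a ∈ flowLattice o ↔ ∀ x ∈ V(G), boundary ℤ o.tail o.head a x = 0 := by
    simp only [boundary_apply_apply]
    exact forall₂_congr fun x _ => by congr!
  rw [hiff, IsCirculation, Finsupp.ext_iff]
  refine ⟨fun ha x => ?_, fun ha x _ => ha x⟩
  by_cases hx : x ∈ V(G)
  · exact ha x hx
  · have hhead (e : E(G)) : o.head e ≠ x := by rintro rfl; exact hx (o.isLink e).right_mem
    have htail (e : E(G)) : o.tail e ≠ x := by rintro rfl; exact hx (o.isLink e).left_mem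
    simp [boundary_apply_apply, hhead, htail]

/-- The matrix whose rows are the basis flows. -/
noncomputable def flowMatrix (b : Module.Basis (Fin r) ℤ (flowLattice o)) : Matrix (Fin r) E(G) ℤ :=
  fun i e => (b i : E(G) → ℤ) e

variable {b : Module.Basis (Fin r) ℤ (flowLattice o)}

lemma gramMatrix_eq : gramMatrix b = flowMatrix b * (flowMatrix b)ᵀ := by
  ext i j
  simp [gramMatrix, pairing, Matrix.mul_apply, flowMatrix]

lemma flowOf_eq (v : Fin r → ℤ) : flowOf b v = v ᵥ* flowMatrix b := by
  ext e
  simp [flowOf, Matrix.vecMul, dotProduct, flowMatrix]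

lemma isCirculation_flowMatrix (i : Fin r) : IsCirculation o.tail o.head (flowMatrix b i) :=
  (mem_flowLattice_iff _).mp (b i).2

lemma exists_vecMul_flowMatrix_eq {a : E(G) → ℤ} (ha : IsCirculation o.tail o.head a) :
    ∃ u, u ᵥ* flowMatrix b = a := by
  refine ⟨b.repr ⟨a, (mem_flowLattice_iff a).mpr ha⟩, ?_⟩
  rw [← flowOf_eq, flowOf, b.sum_repr]

lemma eq_zero_of_vecMul_flowMatrix {u : Fin r → ℤ} (hu : u ᵥ* flowMatrix b = 0) : u = 0 := by
  rw [← flowOf_eq] at hu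
  exact funext (Fintype.linearIndependent_iff.mp b.linearIndependent u (Subtype.ext hu))

lemma exists_boundary_single_eq [DecidableEq E(G)] {F : Set β} {x y : α}
    (h : (G.deleteEdges F).Adj x y) : ∃ (e : E(G)) (s : ℤ), e.1 ∉ F ∧
      boundary ℤ o.tail o.head (Pi.single e s) = Finsupp.single y 1 - Finsupp.single x 1 := by
  obtain ⟨d, hd⟩ := h
  rw [Graph.deleteEdges_isLink] at hd
  rcases (o.isLink ⟨d, hd.1.edge_mem⟩).eq_and_eq_or_eq_and_eq hd.1 with ⟨ht, hh⟩ | ⟨ht, hh⟩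
  · exact ⟨⟨d, hd.1.edge_mem⟩, 1, hd.2, by rw [boundary_single, ht, hh, one_smul]⟩
  · exact ⟨⟨d, hd.1.edge_mem⟩, -1, hd.2, by rw [boundary_single, ht, hh, neg_one_smul, neg_sub]⟩

lemma exists_boundary_eq {F : Set β} {x y : α}
    (h : Relation.ReflTransGen (G.deleteEdges F).Adj x y) :
    ∃ p : E(G) → ℤ, (∀ e, e.1 ∈ F → p e = 0) ∧
      boundary ℤ o.tail o.head p = Finsupp.single y 1 - Finsupp.single x 1 := by
  classical
  induction h with
  | refl => exact ⟨0, fun _ _ => rfl, by rw [map_zero, sub_self]⟩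
  | tail _ hadj ih =>
    obtain ⟨p, hpF, hp⟩ := ih
    obtain ⟨d, s, hdF, hd⟩ := exists_boundary_single_eq (o := o) hadj
    refine ⟨p + Pi.single d s, fun e he => ?_, ?_⟩
    · rw [Pi.add_apply, hpF e he, Pi.single_eq_of_ne (by rintro rfl; exact hdF he), add_zero]
    · rw [map_add, hp, hd, sub_add_sub_cancel']

lemma exists_flow_through {F : Set β} (hF : Connected (G.deleteEdges F)) {e : E(G)}
    (he : e.1 ∈ F) : ∃ u : Fin r → ℤ, (u ᵥ* flowMatrix b) e = 1 ∧
      ∀ f, f.1 ∈ F → f ≠ e → (u ᵥ* flowMatrix b) f = 0 := by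
  classical
  obtain ⟨p, hpF, hp⟩ := exists_boundary_eq (o := o) (hF.2 (o.head e) (o.isLink e).right_mem
    (o.tail e) (o.isLink e).left_mem)
  have hcirc : IsCirculation o.tail o.head (p + Pi.single e 1) := by
    rw [IsCirculation, map_add, hp, boundary_single, one_smul]
    abel
  obtain ⟨u, hu⟩ := exists_vecMul_flowMatrix_eq (b := b) hcirc
  refine ⟨u, ?_, fun f hf hfe => ?_⟩
  · rw [hu, Pi.add_apply, hpF e he, Pi.single_eq_same, zero_add]
  · rw [hu, Pi.add_apply, hpF f hf, Pi.single_eq_of_ne hfe, zero_add]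

theorem isRegular_flowMatrix (hG : TwoEdgeConnected G) : IsRegular (flowMatrix b) :=
  isRegular_of_circulations (fun _ => eq_zero_of_vecMul_flowMatrix) isCirculation_flowMatrix
    (fun _ => exists_vecMul_flowMatrix_eq) fun e => by
      obtain ⟨u, hu, -⟩ := exists_flow_through (b := b) (hG.2 e.1 e.2) (Set.mem_singleton e.1)
      by_contra! hcon
      simp [Matrix.vecMul, dotProduct, hcon] at hu

end FlowMatrix

section Circuits

variable {α β : Type*} {G : Graph α β} {o : Orientation G}

lemma isCircuitElement_iff (a : E(G) → ℤ) : IsCircuitElement o a ↔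
    ∃ k v e s, IsSimpleClosedWalk G k v e ∧ IsSignedWalk o.tail o.head k v e s ∧
      a = walkVec e s := by
  refine ⟨fun ⟨k, v, e, hw, s, hs, ha⟩ => ⟨k, v, e, s, hw, hs, ha.trans ?_⟩,
    fun ⟨k, v, e, s, hw, hs, ha⟩ => ⟨k, v, e, hw, s, hs, ha.trans ?_⟩⟩ <;>
  · rw [walkVec]
    congr!

variable {k : ℕ} {v : Fin (k + 1) → α} {e : Fin (k + 1) → E(G)}

lemma IsSignedWalk.isSimpleClosedWalk {s : Fin (k + 1) → ℤ}
    (h : IsSignedWalk o.tail o.head k v e s) (hv : v.Injective) (he : e.Injective) :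
    IsSimpleClosedWalk G k v e := by
  refine ⟨hv, he, fun i => ?_⟩
  have hlink := o.isLink (e i)
  rcases h i with ⟨-, h1, h2⟩ | ⟨-, h1, h2⟩
  · rwa [h1, h2] at hlink
  · rw [h1, h2] at hlink
    exact hlink.symm

lemma IsSimpleClosedWalk.exists_isSignedWalk (h : IsSimpleClosedWalk G k v e) :
    ∃ s, IsSignedWalk o.tail o.head k v e s := by
  suffices h : ∀ i, ∃ s : ℤ, (s = 1 ∧ o.tail (e i) = v i ∧ o.head (e i) = v (i + 1)) ∨
      (s = -1 ∧ o.head (e i) = v i ∧ o.tail (e i) = v (i + 1)) from Classical.skolem.mp h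
  intro i
  rcases (o.isLink (e i)).eq_and_eq_or_eq_and_eq (h.2.2 i) with hi | hi
  · exact ⟨1, Or.inl ⟨rfl, hi⟩⟩
  · exact ⟨-1, Or.inr ⟨rfl, hi.2, hi.1⟩⟩

lemma isCircuit_iff_exists_isCircuitElement (X : Set E(G)) :
    IsCircuit G X ↔ ∃ a, IsCircuitElement o a ∧ X = edgeSupport a := by
  simp only [isCircuitElement_iff]
  constructor
  · rintro ⟨k, v, e, hsw, rfl⟩
    obtain ⟨s, hw⟩ := hsw.exists_isSignedWalk (o := o)
    exact ⟨_, ⟨k, v, e, s, hsw, hw, rfl⟩,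
      Set.ext fun d => (hw.walkVec_ne_zero_iff hsw.2.1 d).symm⟩
  · rintro ⟨_, ⟨k, v, e, s, hsw, hw, rfl⟩, rfl⟩
    exact ⟨k, v, e, hsw, Set.ext (hw.walkVec_ne_zero_iff hsw.2.1)⟩

variable [Fintype E(G)] {r : ℕ} {b : Module.Basis (Fin r) ℤ (flowLattice o)}

lemma IsElementary.isCircuitElement (hG : TwoEdgeConnected G) {v : Fin r → ℤ}
    (hv : IsElementary (flowMatrix b) v) : IsCircuitElement o (flowOf b v) := by
  obtain ⟨k, x, e, s, hx, he, hw, hpos⟩ :=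
    (isCirculation_coord isCirculation_flowMatrix (toReal v)).exists_signedWalk
      (mt ((isRegular_flowMatrix (b := b) hG).inj _) (toReal_ne_zero hv.ne_zero))
  obtain ⟨u, hu⟩ := exists_vecMul_flowMatrix_eq (b := b) hw.isCirculation
  have hconf : Conforms (flowMatrix b) (toReal u) (toReal v) := by
    intro d hd
    rw [coord_toReal, hu] at hd ⊢
    obtain ⟨i, rfl⟩ := (hw.walkVec_ne_zero_iff he d).mp (mod_cast hd)
    rw [walkVec_apply he]
    exact hpos i
  have huv : u = v := hv.eq_of_conforms (fun d => hu ▸ hw.abs_walkVec_le he d)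
    (e := e 0) (hu ▸ (hw.walkVec_ne_zero_iff he _).mpr ⟨0, rfl⟩) hconf
  rw [isCircuitElement_iff, flowOf_eq, ← huv]
  exact ⟨k, x, e, s, hw.isSimpleClosedWalk hx he, hw, hu⟩

lemma isElementary_of_isCircuitElement (hG : TwoEdgeConnected G) {v : Fin r → ℤ}
    (hv : IsCircuitElement o (flowOf b v)) : IsElementary (flowMatrix b) v := by
  rw [isCircuitElement_iff, flowOf_eq] at hv
  obtain ⟨k, x, e, s, hsw, hw, hv⟩ := hv
  refine ⟨?_, fun d => hv ▸ hw.abs_walkVec_le hsw.2.1 d, fun y hy => ?_⟩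
  · rintro rfl
    refine (hw.walkVec_ne_zero_iff hsw.2.1 (e 0)).mpr ⟨0, rfl⟩ ?_
    rw [← hv, Matrix.zero_vecMul, Pi.zero_apply]
  · obtain ⟨t, ht⟩ := hw.exists_eq_mul_walkVec hsw.1 hsw.2.1
      (isCirculation_coord (isCirculation_flowMatrix (b := b)) y) fun d hd => by
        apply hy
        rw [coord_toReal, hv, walkVec_of_notMem hd, Int.cast_zero]
    refine ⟨t, sub_eq_zero.mp ((isRegular_flowMatrix (b := b) hG).inj _ ?_)⟩
    ext d
    simp [coord_toReal, hv, ht]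

theorem isElementary_iff_isCircuitElement (hG : TwoEdgeConnected G) (v : Fin r → ℤ) :
    IsElementary (flowMatrix b) v ↔ IsCircuitElement o (flowOf b v) :=
  ⟨fun hv => hv.isCircuitElement hG, isElementary_of_isCircuitElement hG⟩

theorem isCircuit_iff_exists_isElementary (hG : TwoEdgeConnected G) (X : Set E(G)) :
    IsCircuit G X ↔ ∃ v, IsElementary (flowMatrix b) v ∧ X = edgeSupport (flowOf b v) := by
  simp only [isCircuit_iff_exists_isCircuitElement (o := o), isElementary_iff_isCircuitElement hG]
  refine ⟨fun ⟨a, ha, hX⟩ => ?_, fun ⟨v, hv⟩ => ⟨_, hv⟩⟩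
  obtain ⟨k, v, e, s, -, hw, rfl⟩ := (isCircuitElement_iff a).mp ha
  obtain ⟨u, hu⟩ := exists_vecMul_flowMatrix_eq (b := b) hw.isCirculation
  exact ⟨u, by rwa [flowOf_eq, hu], by rwa [flowOf_eq, hu]⟩

end Circuits

section TwoCuts

variable {α β : Type*} {G : Graph α β} (o : Orientation G) {F : Set β}

lemma Orientation.exists_potential_of_not_connected (hV : V(G).Nonempty)
    (h : ¬ Connected (G.deleteEdges F)) :
    ∃ p : α → ℝ, (∀ d : E(G), d.1 ∉ F → p (o.head d) = p (o.tail d)) ∧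
      ∃ x ∈ V(G), ∃ y ∈ V(G), p x ≠ p y := by
  classical
  obtain ⟨x, hx, y, hy, hxy⟩ : ∃ x ∈ V(G), ∃ y ∈ V(G),
      ¬ Relation.ReflTransGen (G.deleteEdges F).Adj x y := by
    by_contra! hcon
    exact h ⟨hV, hcon⟩
  refine ⟨fun w => if Relation.ReflTransGen (G.deleteEdges F).Adj x w then 1 else 0,
    fun d hd => ?_, x, hx, y, hy, by simp [hxy, Relation.ReflTransGen.refl]⟩
  have hadj : (G.deleteEdges F).Adj (o.tail d) (o.head d) :=
    ⟨d.1, (Graph.deleteEdges_isLink ..).mpr ⟨o.isLink d, hd⟩⟩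
  exact if_congr ⟨fun hr => hr.tail hadj.symm, fun hr => hr.tail hadj⟩ rfl rfl

lemma Orientation.potential_eq_of_connected {p : α → ℝ}
    (hp : ∀ d : E(G), d.1 ∉ F → p (o.head d) = p (o.tail d))
    (hF : Connected (G.deleteEdges F)) {x y : α} (hx : x ∈ V(G)) (hy : y ∈ V(G)) : p x = p y := by
  have hwalk := hF.2 x hx y hy
  clear hy
  induction hwalk with
  | refl => rfl
  | tail _ hadj ih =>
    obtain ⟨d, hd⟩ := hadj
    rw [Graph.deleteEdges_isLink] at hd
    have hd' := hp ⟨d, hd.1.edge_mem⟩ hd.2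
    rcases (o.isLink ⟨d, hd.1.edge_mem⟩).eq_and_eq_or_eq_and_eq hd.1 with ⟨ht, hh⟩ | ⟨ht, hh⟩
    · exact ih.trans ((congrArg p ht).symm.trans (hd'.symm.trans (congrArg p hh)))
    · exact ih.trans ((congrArg p hh).symm.trans (hd'.trans (congrArg p ht)))

variable {o} [Fintype E(G)] {r : ℕ} {b : Module.Basis (Fin r) ℤ (flowLattice o)}

lemma IsTwoCut.parallelCoords (hG : TwoEdgeConnected G) {e f : E(G)} (h : IsTwoCut G e f) :
    ParallelCoords (flowMatrix b) e f := by
  obtain ⟨p, hp, x, hx, y, hy, hxy⟩ := o.exists_potential_of_not_connected hG.1.1 h.2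
  have hconst (d : E(G)) (hde : d ≠ e) (hdf : d ≠ f) : p (o.head d) = p (o.tail d) :=
    hp d fun hd => hd.elim (fun hd => hde (Subtype.ext hd)) fun hd => hdf (Subtype.ext hd)
  have hf : p (o.head f) - p (o.tail f) ≠ 0 := by
    refine fun h0 => hxy (o.potential_eq_of_connected (fun d hd => ?_) (hG.2 e e.2) hx hy)
    rcases eq_or_ne d f with rfl | hdf
    · exact sub_eq_zero.mp h0
    · exact hconst d (fun hde => hd (congrArg Subtype.val hde)) hdf
  intro z hz
  have hsum := (isCirculation_coord (isCirculation_flowMatrix (b := b)) z).sum_mul_sub p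
  rw [Fintype.sum_eq_add e f h.1 fun d hd => by rw [hconst d hd.1 hd.2, sub_self, mul_zero], hz,
    zero_mul, zero_add] at hsum
  exact (mul_eq_zero.mp hsum).resolve_right hf

theorem parallelCoords_flowMatrix_iff (hG : TwoEdgeConnected G) (e f : E(G)) :
    ParallelCoords (flowMatrix b) e f ↔ e = f ∨ IsTwoCut G e f := by
  refine ⟨fun hpar => or_iff_not_imp_left.mpr fun hef => ⟨hef, fun hconn => ?_⟩, ?_⟩
  · obtain ⟨u, huf, hue⟩ := exists_flow_through (b := b) hconn (e := f) (by simp)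
    have := hpar (toReal u)
    simp [coord_toReal, huf, hue e (by simp) hef] at this
  · rintro (rfl | h)
    · exact fun _ => id
    · exact h.parallelCoords hG

end TwoCuts

section Multisets

variable {ι ι' K M : Type*} [Fintype ι] [Fintype ι'] [Field K] [CharZero K] [AddCommGroup M]
  [Module K M] {f : ι → M} {g : ι' → M}

lemma exists_equiv_of_linearIndepOn_of_sum_eq (hfg : LinearIndepOn K id (Set.range (Sum.elim f g)))
    (hsum : ∑ i, f i = ∑ i, g i) : ∃ σ : ι ≃ ι', ∀ i, g (σ i) = f i := by
  classical
  have hf : ∑ i, Finsupp.single (f i) (1 : K) = ∑ i, Finsupp.single (g i) 1 := by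
    refine linearIndepOn_iffₛ.mp hfg _ (sum_mem fun i _ => ?_) _ (sum_mem fun i _ => ?_) ?_
    · exact Finsupp.single_mem_supported _ _ ⟨Sum.inl i, rfl⟩
    · exact Finsupp.single_mem_supported _ _ ⟨Sum.inr i, rfl⟩
    · simpa using hsum
  have hcard (m : M) : Nonempty ({i // f i = m} ≃ {i // g i = m}) := by
    refine ⟨Fintype.equivOfCardEq ?_⟩
    have := DFunLike.congr_fun hf m
    simp only [Finsupp.finsetSum_apply, Finsupp.single_apply, Finset.sum_boole,
      Nat.cast_inj] at this
    simpa only [Fintype.card_subtype] using this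
  exact ⟨.ofFiberEquiv fun m => (hcard m).some, Equiv.ofFiberEquiv_map _⟩

end Multisets

section SignRepresentatives

variable {E E' : Type*} {r : ℕ} {B : Matrix (Fin r) E ℤ} {B' : Matrix (Fin r) E' ℤ}

/-- Every lattice vector is congruent to a sign vector modulo `2`. Regular lattices have this
property, and unlike regularity it is witnessed by finitely many integers. -/
def HasSignRepresentatives (B : Matrix (Fin r) E ℤ) : Prop :=
  ∀ v : Fin r → ℤ, ∃ w : Fin r → ℤ, IsSignVector B (v + 2 • w)

lemma vecMul_add_two_smul (v w : Fin r → ℤ) (e : E) :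
    ((v + 2 • w) ᵥ* B) e = (v ᵥ* B) e + 2 * (w ᵥ* B) e := by
  rw [Matrix.add_vecMul, Matrix.smul_vecMul, Pi.add_apply, Pi.smul_apply, nsmul_eq_mul,
    Nat.cast_ofNat]

lemma HasSignRepresentatives.exists_isSignVector_ne_zero (h : HasSignRepresentatives B) {e : E}
    (he : ∃ i, B i e ≠ 0) : ∃ u, IsSignVector B u ∧ (u ᵥ* B) e ≠ 0 := by
  by_contra! hcon
  suffices hzero : ∀ v : Fin r → ℤ, (v ᵥ* B) e = 0 by
    obtain ⟨i, hi⟩ := he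
    exact hi (by simpa using hzero (Pi.single i 1))
  intro v
  induction hn : ((v ᵥ* B) e).natAbs using Nat.strong_induction_on generalizing v with
  | _ n ih =>
    obtain ⟨w, hw⟩ := h v
    have hvw := hcon _ hw
    rw [vecMul_add_two_smul] at hvw
    by_contra hv
    have := ih _ (by omega) w rfl
    omega

lemma ParallelCoords.coord_eq {e f : E} (hef : ParallelCoords B e f) {u : Fin r → ℝ}
    (hu : coord B u e ≠ 0) (z : Fin r → ℝ) :
    coord B z f = coord B z e / coord B u e * coord B u f := by
  have hf := hef (z - (coord B z e / coord B u e) • u) (by simp [div_mul_cancel₀ _ hu])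
  simpa [sub_eq_zero] using hf

lemma HasSignRepresentatives.abs_coord_eq (h : HasSignRepresentatives B)
    (hcol : ∀ e, ∃ i, B i e ≠ 0) {e f : E} (hef : ParallelCoords B e f) (z : Fin r → ℝ) :
    |coord B z f| = |coord B z e| := by
  have habs {a : ℤ} (ha : |a| ≤ 1) (ha0 : a ≠ 0) : |(a : ℝ)| = 1 :=
    mod_cast ha.antisymm (Int.one_le_abs ha0)
  obtain ⟨u, hu, hue⟩ := h.exists_isSignVector_ne_zero (hcol e)
  obtain ⟨u', -, huf'⟩ := h.exists_isSignVector_ne_zero (hcol f)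
  have hcoord := hef.coord_eq (u := toReal u) (by rwa [coord_toReal, Int.cast_ne_zero])
  simp only [coord_toReal u] at hcoord
  have huf : (u ᵥ* B) f ≠ 0 := fun h0 => huf' (by
    have := hcoord (toReal u')
    rwa [h0, Int.cast_zero, mul_zero, coord_toReal, Int.cast_eq_zero] at this)
  rw [hcoord z, abs_mul, abs_div, habs (hu e) hue, habs (hu f) huf, div_one, mul_one]

theorem HasSignRepresentatives.linearIndepOn_abs [Finite E] (h : HasSignRepresentatives B)
    (hcol : ∀ e, ∃ i, B i e ≠ 0) :
    LinearIndepOn ℝ id (Set.range fun (e : E) (z : Fin r → ℝ) => |coord B z e|) := by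
  choose d hd using fun s : Set.range fun (e : E) (z : Fin r → ℝ) => |coord B z e| => s.2
  have hli := linearIndependent_abs (w := fun s => coordFun B (d s)) (fun s hs => ?_)
    fun s s' hne => ?_
  · simpa only [LinearIndepOn, id, ← hd] using! hli
  · obtain ⟨u, -, hu⟩ := h.exists_isSignVector_ne_zero (hcol (d s))
    refine hu ?_
    rw [← Int.cast_eq_zero (α := ℝ), ← coord_toReal]
    exact DFunLike.congr_fun hs (toReal u)
  · by_contra! hpar
    refine hne (Subtype.ext ?_)
    rw [← hd s, ← hd s']
    exact funext fun z => (h.abs_coord_eq hcol hpar z).symm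

lemma abs_le_abs_add_two_mul {a : ℤ} (ha : |a| ≤ 1) (c : ℤ) : |a| ≤ |a + 2 * c| := by
  obtain ⟨_, _⟩ | ⟨_, _⟩ := abs_cases a <;> obtain ⟨_, _⟩ | ⟨_, _⟩ := abs_cases (a + 2 * c) <;>
    omega

variable [Fintype E] [Fintype E']

lemma IsSignVector.add_two_smul {v w : Fin r → ℤ} (hv : IsSignVector B v)
    (hle : latticeForm (B * Bᵀ) (v + 2 • w) (v + 2 • w) ≤ latticeForm (B * Bᵀ) v v) :
    IsSignVector B (v + 2 • w) := by
  simp only [latticeForm_mul_transpose, vecMul_add_two_smul] at hle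
  have hterm (e : E) (_ : e ∈ Finset.univ) : (v ᵥ* B) e * (v ᵥ* B) e ≤
      ((v ᵥ* B) e + 2 * (w ᵥ* B) e) * ((v ᵥ* B) e + 2 * (w ᵥ* B) e) :=
    abs_le_iff_mul_self_le.mp (abs_le_abs_add_two_mul (hv e) _)
  intro e
  have heq := (Finset.sum_eq_sum_iff_of_le hterm).mp
    ((Finset.sum_le_sum hterm).antisymm hle) e (Finset.mem_univ e)
  rw [vecMul_add_two_smul, ← abs_eq_iff_mul_self_eq.mpr heq]
  exact hv e

lemma IsSignVector.latticeForm_le {v : Fin r → ℤ} (hv : IsSignVector B v) (w : Fin r → ℤ) :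
    latticeForm (B * Bᵀ) v v ≤ latticeForm (B * Bᵀ) (v + 2 • w) (v + 2 • w) := by
  simp only [latticeForm_mul_transpose, vecMul_add_two_smul]
  exact Finset.sum_le_sum fun e _ => abs_le_iff_mul_self_le.mp (abs_le_abs_add_two_mul (hv e) _)

lemma HasSignRepresentatives.isSignVector_of_gram_eq (h : HasSignRepresentatives B')
    (hg : B * Bᵀ = B' * B'ᵀ) {v : Fin r → ℤ} (hv : IsSignVector B v) : IsSignVector B' v := by
  obtain ⟨w, hw⟩ := h v
  have hle := hv.latticeForm_le w
  rw [hg] at hle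
  simpa using hw.add_two_smul (w := -w) (by simpa using hle)

lemma gramForm_toReal (u w : Fin r → ℤ) :
    gramForm B (toReal u) (toReal w) = (latticeForm (B * Bᵀ) u w : ℝ) := by
  simp [gramForm_apply, coord_toReal, latticeForm_mul_transpose]

lemma half_smul_mem_voronoiCell {u : Fin r → ℤ}
    (hu : ∀ w, latticeForm (B * Bᵀ) u u ≤ latticeForm (B * Bᵀ) (u + 2 • w) (u + 2 • w)) :
    (1 / 2 : ℝ) • toReal u ∈ voronoiCell (B * Bᵀ) := by
  refine (mem_voronoiCell_iff _).mpr fun w => ?_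
  have hw : gramForm B (toReal u) (toReal u) ≤
      gramForm B (toReal u - (2 : ℝ) • toReal w) (toReal u - (2 : ℝ) • toReal w) := by
    have hsub : toReal u - (2 : ℝ) • toReal w = toReal (u + 2 • -w) := by
      ext i
      simp [toReal, sub_eq_add_neg]
    rw [hsub, gramForm_toReal, gramForm_toReal]
    exact_mod_cast hu (-w)
  simp only [map_sub, map_smul, LinearMap.sub_apply, LinearMap.smul_apply, smul_eq_mul,
    gramForm_comm (toReal w) (toReal u)] at hw ⊢
  linarith

omit [Fintype E] in
/-- A shortest vector of a class modulo `2` is twice a point of the Voronoi cell. -/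
theorem IsRegular.hasSignRepresentatives [Finite E] (h : IsRegular B) :
    HasSignRepresentatives B := by
  have := Fintype.ofFinite E
  intro v
  let q (u : Fin r → ℤ) : ℤ := latticeForm (B * Bᵀ) u u
  have hq (u : Fin r → ℤ) : 0 ≤ q u := by
    simp only [q, latticeForm_mul_transpose]
    exact Finset.sum_nonneg fun e _ => mul_self_nonneg _
  let w := Function.argmin fun w => (q (v + 2 • w)).toNat
  refine ⟨w, ?_⟩
  set u := v + 2 • w
  have hcell := half_smul_mem_voronoiCell (B := B) (u := u) fun w' => by
    have hmin := Function.argmin_le (fun w => (q (v + 2 • w)).toNat) (w + w')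
    rw [smul_add, ← add_assoc] at hmin
    exact (Int.toNat_le.mp hmin).trans_eq (Int.toNat_of_nonneg (hq _))
  have hle := h.gramForm_le_normOne hcell (toReal u)
  rw [map_smul, LinearMap.smul_apply, smul_eq_mul] at hle
  have heq : normOne B (toReal u) = gramForm B (toReal u) (toReal u) :=
    (normOne_le_gramForm_self u).antisymm (by linarith)
  simp only [gramForm_apply, normOne, coord_toReal] at heq
  have hterm := (Finset.sum_eq_sum_iff_of_le fun e _ => abs_le_mul_self ((u ᵥ* B) e)).mp
    (mod_cast heq)
  intro e
  have he := hterm e (Finset.mem_univ e)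
  rw [← abs_mul_abs_self] at he
  nlinarith [abs_nonneg ((u ᵥ* B) e)]

omit [Fintype E] in
lemma SignAgree.of_add_smul {w u z : Fin r → ℝ} {t : ℝ} (h : SignAgree B w (z + t • u))
    (huz : SignAgree B u z) (ht : 0 < t) : SignAgree B w u ∧ SignAgree B w z := by
  refine forall_and.mp fun e => ?_
  have hadd := h e
  rw [map_add, map_smul, Pi.add_apply, Pi.smul_apply, smul_eq_mul, mul_add, mul_left_comm] at hadd
  have hmul : 0 ≤ (coord B w e * coord B u e) * (coord B w e * coord B z e) := by
    rw [mul_mul_mul_comm]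
    exact mul_nonneg (mul_self_nonneg _) (huz e)
  constructor <;> by_contra! hneg
  · have := mul_neg_of_pos_of_neg ht hneg
    exact hmul.not_gt (mul_neg_of_neg_of_pos hneg (by linarith))
  · have hpos : 0 < t * (coord B w e * coord B u e) := by linarith
    exact hmul.not_gt (mul_neg_of_pos_of_neg (pos_of_mul_pos_right hpos ht.le) hneg)

omit [Fintype E] [Fintype E'] in
lemma SignAgree.add_smul {w u z : Fin r → ℝ} {t : ℝ} (hu : SignAgree B w u) (hz : SignAgree B w z)
    (ht : 0 ≤ t) : SignAgree B w (z + t • u) := by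
  intro e
  rw [map_add, map_smul, Pi.add_apply, Pi.smul_apply, smul_eq_mul, mul_add, mul_left_comm]
  exact add_nonneg (hz e) (mul_nonneg ht (hu e))

theorem IsRegular.normOne_eq (h : IsRegular B) (h' : HasSignRepresentatives B')
    (hg : B * Bᵀ = B' * B'ᵀ) (z : Fin r → ℝ) : normOne B' z = normOne B z := by
  have hform (x : Fin r → ℝ) : gramForm B' x x = gramForm B x x := by rw [gramForm, gramForm, hg]
  suffices normOne B' z = normOne B z ∧ ∀ w, IsSignVector B w → SignAgree B (toReal w) z →
      SignAgree B' (toReal w) z from this.1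
  induction z using h.induction with
  | zero => simp [normOne, SignAgree]
  | add u t z hu ht hagree ih =>
    have hsign {w : Fin r → ℤ} (hw : IsSignVector B w) := h'.isSignVector_of_gram_eq hg hw
    refine ⟨?_, fun w hw hwz => ?_⟩
    · rw [hagree.normOne_add_smul ht.le, (ih.2 u hu hagree).normOne_add_smul ht.le, ih.1,
        ← hu.gramForm_self, ← (hsign hu).gramForm_self, hform]
    · obtain ⟨hwu, hwz⟩ := hwz.of_add_smul hagree ht
      refine SignAgree.add_smul ?_ (ih.2 w hw hwz) ht.le
      exact ((hsign hw).signAgree_iff (hsign hu)).mpr (hsign ((hw.signAgree_iff hu).mp hwu))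

lemma HasSignRepresentatives.fromCols (h : HasSignRepresentatives B)
    (h' : HasSignRepresentatives B') (hg : B * Bᵀ = B' * B'ᵀ) :
    HasSignRepresentatives (Matrix.fromCols B B') := by
  intro v
  obtain ⟨w, hw⟩ := h v
  refine ⟨w, ?_⟩
  rw [IsSignVector, Matrix.vecMul_fromCols]
  exact Sum.forall.mpr ⟨hw, h'.isSignVector_of_gram_eq hg hw⟩

/-- Both families of functions `|coord · e|` sum to the same norm and together they are linearly
independent up to repetitions, so they agree as multisets. -/
theorem IsRegular.exists_equiv_of_gram_eq (h : IsRegular B) (h' : HasSignRepresentatives B')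
    (hcol' : ∀ e, ∃ i, B' i e ≠ 0) (hg : B * Bᵀ = B' * B'ᵀ) :
    ∃ σ : E' ≃ E, ∀ e z, |coord B z (σ e)| = |coord B' z e| := by
  have hli := (h'.fromCols h.hasSignRepresentatives hg.symm).linearIndepOn_abs
    (Sum.forall.mpr ⟨hcol', h.col_ne⟩)
  have hcoord : (fun (e : E' ⊕ E) z => |coord (Matrix.fromCols B' B) z e|) =
      Sum.elim (fun e z => |coord B' z e|) (fun e z => |coord B z e|) := by
    ext e z
    cases e <;> rfl
  have hsum : ∑ e, (fun z => |coord B' z e|) = ∑ e, fun z => |coord B z e| := by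
    ext z
    simpa only [Finset.sum_apply, normOne] using h.normOne_eq h' hg z
  obtain ⟨σ, hσ⟩ := exists_equiv_of_linearIndepOn_of_sum_eq (hcoord ▸ hli) hsum
  exact ⟨σ, fun e => congrFun (hσ e)⟩

end SignRepresentatives

section OddSupport

variable {E : Type*} {r : ℕ} {B : Matrix (Fin r) E ℤ} {u v w : Fin r → ℤ}

/-- The support of a lattice vector modulo `2`. In a regular lattice the classes modulo `2`
correspond to these sets, so the elementary vectors can be found among finitely many classes. -/
def oddSupport (B : Matrix (Fin r) E ℤ) (v : Fin r → ℤ) : Set E := {e | Odd ((v ᵥ* B) e)}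

lemma oddSupport_add_two_smul (v w : Fin r → ℤ) : oddSupport B (v + 2 • w) = oddSupport B v := by
  ext e
  simp only [oddSupport, Set.mem_ofPred_eq, vecMul_add_two_smul]
  rw [Int.odd_add]
  exact iff_true_right (even_two_mul _)

lemma IsSignVector.oddSupport_eq (hu : IsSignVector B u) :
    oddSupport B u = {e | (u ᵥ* B) e ≠ 0} := by
  ext e
  obtain he | he | he := Int.abs_le_one_iff.mp (hu e) <;> simp [oddSupport, he]

lemma IsSignVector.oddSupport_subset_iff (hu : IsSignVector B u) (hv : IsSignVector B v) :
    oddSupport B u ⊆ oddSupport B v ↔ toReal u ∈ supportSpace B (toReal v) := by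
  rw [hu.oddSupport_eq, hv.oddSupport_eq, Set.ofPred_subset_ofPred]
  refine forall_congr' fun e => ?_
  rw [coord_toReal, coord_toReal, Int.cast_eq_zero, Int.cast_eq_zero, not_imp_not]

lemma IsRegular.oddSupport_nonempty_iff (h : IsRegular B) (hu : IsSignVector B u) :
    (oddSupport B u).Nonempty ↔ u ≠ 0 := by
  constructor
  · rintro ⟨e, he⟩ rfl
    simp [oddSupport] at he
  · intro hu0
    obtain ⟨e, he⟩ := h.exists_coord_ne_zero (toReal_ne_zero hu0)
    rw [coord_toReal, Int.cast_ne_zero] at he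
    exact hu.oddSupport_eq ▸ ⟨e, he⟩

lemma IsElementary.minimal_oddSupport [Finite E] (hv : IsElementary B v) (h : IsRegular B) :
    Minimal (fun X => X.Nonempty ∧ X ∈ Set.range (oddSupport B)) (oddSupport B v) := by
  refine ⟨⟨(h.oddSupport_nonempty_iff hv.sign).mpr hv.ne_zero, v, rfl⟩, ?_⟩
  rintro X ⟨hX, w, rfl⟩ hwv
  obtain ⟨w', hu⟩ := h.hasSignRepresentatives w
  rw [← oddSupport_add_two_smul w w'] at hX hwv ⊢
  obtain ⟨t, ht⟩ := hv.eq_smul _ ((hu.oddSupport_subset_iff hv.sign).mp hwv)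
  have ht0 : t ≠ 0 := by
    rintro rfl
    exact toReal_ne_zero ((h.oddSupport_nonempty_iff hu).mp hX) (by rw [ht, zero_smul])
  refine (hv.sign.oddSupport_subset_iff hu).mpr fun e he => ?_
  rw [ht, map_smul] at he
  exact (mul_eq_zero.mp he).resolve_left ht0

lemma IsRegular.isElementary_of_minimal (h : IsRegular B) (hv : IsSignVector B v)
    (hmin : Minimal (fun X => X.Nonempty ∧ X ∈ Set.range (oddSupport B)) (oddSupport B v)) :
    IsElementary B v := by
  have hv0 := (h.oddSupport_nonempty_iff hv).mp hmin.prop.1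
  refine ⟨hv0, hv, fun y hy => ?_⟩
  obtain ⟨e, he⟩ := h.exists_coord_ne_zero (toReal_ne_zero hv0)
  let t := coord B y e / coord B (toReal v) e
  refine ⟨t, sub_eq_zero.mp ?_⟩
  by_contra hz
  obtain ⟨u, hu0, hu, huz⟩ := h.conformal _ hz
  have hsub : y - t • toReal v ∈ supportSpace B (toReal v) :=
    sub_mem hy (Submodule.smul_mem _ t (mem_supportSpace_self _))
  have huv := (hu.oddSupport_subset_iff hv).mpr (supportSpace_le hsub huz.mem_supportSpace)
  have hvu := hmin.2 ⟨(h.oddSupport_nonempty_iff hu).mpr hu0, u, rfl⟩ huv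
  refine he ((hv.oddSupport_subset_iff hu).mp hvu e (huz.mem_supportSpace e ?_))
  simp [t, div_mul_cancel₀ _ he]

theorem IsRegular.minimal_oddSupport_iff [Finite E] (h : IsRegular B) (X : Set E) :
    Minimal (fun X => X.Nonempty ∧ X ∈ Set.range (oddSupport B)) X ↔
      ∃ v, IsElementary B v ∧ X = {e | (v ᵥ* B) e ≠ 0} := by
  constructor
  · intro hX
    obtain ⟨v, rfl⟩ := hX.prop.2
    obtain ⟨w, hu⟩ := h.hasSignRepresentatives v
    rw [← oddSupport_add_two_smul v w] at hX ⊢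
    exact ⟨v + 2 • w, h.isElementary_of_minimal hu hX, hu.oddSupport_eq⟩
  · rintro ⟨v, hv, rfl⟩
    exact hv.sign.oddSupport_eq ▸ hv.minimal_oddSupport h

lemma IsRegular.exists_eq_add_two_smul [Finite E] (h : IsRegular B)
    (huv : oddSupport B u = oddSupport B v) : ∃ w, u = v + 2 • w := by
  obtain ⟨w, hw⟩ := h.hasSignRepresentatives (u - v)
  have hempty : ¬ (oddSupport B (u - v + 2 • w)).Nonempty := by
    rintro ⟨e, he⟩
    rw [oddSupport_add_two_smul] at he
    have hiff : Odd ((u ᵥ* B) e) ↔ Odd ((v ᵥ* B) e) := Set.ext_iff.mp huv e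
    rw [oddSupport, Set.mem_ofPred_eq, Matrix.sub_vecMul, Pi.sub_apply, Int.odd_sub, hiff,
      ← Int.not_even_iff_odd] at he
    exact not_iff_self he
  have hzero := not_not.mp (mt (h.oddSupport_nonempty_iff hw).mpr hempty)
  refine ⟨-w, ?_⟩
  linear_combination (exp := 1) hzero

end OddSupport

section Primitive

lemma encode_intCast (n : ℕ) : Encodable.encode (n : ℤ) = 2 * n := rfl

lemma encode_negSucc (n : ℕ) : Encodable.encode (Int.negSucc n) = 2 * n + 1 := rfl

lemma primrec_natAbs : Primrec Int.natAbs := by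
  have h : Primrec fun z : ℤ => (Encodable.encode z + 1) / 2 :=
    Primrec.nat_div.comp (Primrec.succ.comp .encode) (.const 2)
  refine h.of_eq fun z => ?_
  cases z with
  | ofNat n => rw [Int.ofNat_eq_natCast, encode_intCast]; omega
  | negSucc n => rw [encode_negSucc]; omega

lemma primrec_toNat : Primrec Int.toNat := by
  have h : Primrec fun z : ℤ =>
      if Encodable.encode z % 2 = 0 then Encodable.encode z / 2 else 0 :=
    .ite (Primrec.eq.comp (Primrec.nat_mod.comp .encode (.const 2)) (.const 0))
      (Primrec.nat_div.comp .encode (.const 2)) (.const 0)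
  refine h.of_eq fun z => ?_
  cases z with
  | ofNat n => rw [Int.ofNat_eq_natCast, encode_intCast, if_pos (by omega)]; omega
  | negSucc n => rw [encode_negSucc, if_neg (by omega)]; omega

lemma primrec_toNat_neg : Primrec fun z : ℤ => (-z).toNat :=
  (Primrec.nat_sub.comp primrec_natAbs primrec_toNat).of_eq fun z => by omega

lemma primrec_intSub_natCast : Primrec₂ fun a b : ℕ => (a : ℤ) - b := by
  have h : Primrec fun p : ℕ × ℕ => if p.2 ≤ p.1 then 2 * (p.1 - p.2) else 2 * (p.2 - p.1) - 1 :=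
    .ite (Primrec.nat_le.comp .snd .fst)
      (Primrec.nat_mul.comp (.const 2) (Primrec.nat_sub.comp .fst .snd))
      (Primrec.pred.comp (Primrec.nat_mul.comp (.const 2) (Primrec.nat_sub.comp .snd .fst)))
  refine Primrec.encode_iff.mp (h.of_eq fun ⟨a, b⟩ => ?_)
  dsimp only
  split_ifs with hab
  · rw [← Nat.cast_sub hab, encode_intCast]
  · rw [show (a : ℤ) - b = Int.negSucc (b - a - 1) by omega, encode_negSucc]
    omega

lemma primrec_intAdd : Primrec₂ fun a b : ℤ => a + b := by
  have h : Primrec fun p : ℤ × ℤ =>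
      ((p.1.toNat + p.2.toNat : ℕ) : ℤ) - ((-p.1).toNat + (-p.2).toNat : ℕ) :=
    primrec_intSub_natCast.comp
      (Primrec.nat_add.comp (primrec_toNat.comp .fst) (primrec_toNat.comp .snd))
      (Primrec.nat_add.comp (primrec_toNat_neg.comp .fst) (primrec_toNat_neg.comp .snd))
  exact h.of_eq fun ⟨a, b⟩ => by dsimp only; omega

lemma primrec_intMul : Primrec₂ fun a b : ℤ => a * b := by
  have h : Primrec fun p : ℤ × ℤ =>
      ((p.1.toNat * p.2.toNat + (-p.1).toNat * (-p.2).toNat : ℕ) : ℤ) -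
        (p.1.toNat * (-p.2).toNat + (-p.1).toNat * p.2.toNat : ℕ) := by
    have hmul {f g : ℤ → ℕ} (hf : Primrec f) (hg : Primrec g) :
        Primrec fun p : ℤ × ℤ => f p.1 * g p.2 :=
      Primrec.nat_mul.comp (hf.comp .fst) (hg.comp .snd)
    exact primrec_intSub_natCast.comp
      (Primrec.nat_add.comp (hmul primrec_toNat primrec_toNat)
        (hmul primrec_toNat_neg primrec_toNat_neg))
      (Primrec.nat_add.comp (hmul primrec_toNat primrec_toNat_neg)
        (hmul primrec_toNat_neg primrec_toNat))
  refine h.of_eq fun p => ?_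
  conv_rhs => rw [← Int.toNat_sub_toNat_neg p.1, ← Int.toNat_sub_toNat_neg p.2]
  push_cast
  ring

lemma primrecPred_odd : PrimrecPred fun z : ℤ => Odd z :=
  (Primrec.eq.comp (Primrec.nat_mod.comp primrec_natAbs (.const 2)) (.const 1)).of_eq fun z => by
    rw [← Nat.odd_iff, Int.natAbs_odd]

variable {α : Type*} [Primcodable α]

lemma primrec_sum_range {n : α → ℕ} {f : α → ℕ → ℤ} (hn : Primrec n) (hf : Primrec₂ f) :
    Primrec fun a => ∑ e ∈ Finset.range (n a), f a e := by
  have h := Primrec.nat_rec' (h := fun a p => p.2 + f a p.1) hn (.const (0 : ℤ))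
    (primrec_intAdd.comp (Primrec.snd.comp .snd) (hf.comp .fst (Primrec.fst.comp .snd)))
  refine h.of_eq fun a => ?_
  induction n a with
  | zero => rfl
  | succ k ih => rw [Finset.sum_range_succ, ← ih]

lemma primrecPred_forall_lt {n : α → ℕ} {p : α → ℕ → Prop} (hn : Primrec n)
    (hp : PrimrecRel p) : PrimrecPred fun a => ∀ x < n a, p a x :=
  (hp.swap.forall_mem_list.comp (Primrec.list_range.comp hn) .id).of_eq fun a => by
    simp [Function.swap]

lemma primrecPred_exists_lt {n : α → ℕ} {p : α → ℕ → Prop} (hn : Primrec n)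
    (hp : PrimrecRel p) : PrimrecPred fun a => ∃ x < n a, p a x :=
  (hp.swap.exists_mem_list.comp (Primrec.list_range.comp hn) .id).of_eq fun a => by
    simp [Function.swap]

lemma primrecPred_imp {p q : α → Prop} (hp : PrimrecPred p) (hq : PrimrecPred q) :
    PrimrecPred fun a => p a → q a :=
  (hp.not.or hq).of_eq fun _ => imp_iff_not_or.symm

lemma primrec_two_pow {n : α → ℕ} (hn : Primrec n) : Primrec fun a => 2 ^ n a :=
  Primrec₂.comp (Primrec₂.unpaired'.mp Nat.Primrec.pow) (.const 2) hn

/-- The entry of a list of rows, with the value `0` outside the list. -/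
def entry (L : List (List ℤ)) (i e : ℕ) : ℤ := (L.getD i []).getD e 0

lemma primrec_entry {L : α → List (List ℤ)} {i e : α → ℕ} (hL : Primrec L) (hi : Primrec i)
    (he : Primrec e) : Primrec fun a => entry (L a) (i a) (e a) :=
  (Primrec.list_getD 0).comp ((Primrec.list_getD []).comp hL hi) he

/-- The `i`-th binary digit of `k`. -/
def bit (k i : ℕ) : ℕ := k / 2 ^ i % 2

lemma primrec_bit : Primrec₂ bit :=
  Primrec.nat_mod.comp (Primrec.nat_div.comp .fst (primrec_two_pow .snd)) (.const 2)

end Primitive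

section Search

/-- The coordinate `e` of the combination of the rows of `M` with coefficients `c`. -/
def combination (M : List (List ℤ)) (r : ℕ) (c : ℕ → ℤ) (e : ℕ) : ℤ :=
  ∑ i ∈ Finset.range r, c i * entry M i e

/-- Coordinate `e` of the lattice vector with coefficients the binary digits of `k` is odd. The
numbers `k < 2 ^ r` stand for the classes modulo `2` of the lattice. -/
def IsOddAt (r : ℕ) (M : List (List ℤ)) (k e : ℕ) : Prop := Odd (combination M r (bit k ·) e)

/-- A candidate realization of a Gram matrix: a triple `(m, M, T)` in which the rows of `M` have
length `m` and span a lattice with the given Gram matrix, and `T` lists, for each class of lattice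
vectors modulo `2`, how to reach a sign vector of that class. -/
abbrev Certificate : Type := ℕ × List (List ℤ) × List (List ℤ)

/-- The decidable conditions under which a certificate determines the elementary vectors. -/
structure IsCertificate (A : List (List ℤ)) (w : Certificate) : Prop where
  gram : ∀ i < A.length, ∀ j < A.length,
    entry A i j = ∑ e ∈ Finset.range w.1, entry w.2.1 i e * entry w.2.1 j e
  ne_zero : ∀ e < w.1, ∃ i < A.length, entry w.2.1 i e ≠ 0
  sign : ∀ k < 2 ^ A.length, ∀ e < w.1,
    (combination w.2.1 A.length (fun i => bit k i + 2 * entry w.2.2 k i) e).natAbs ≤ 1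

/-- The class `k` modulo `2` has minimal nonempty support modulo `2`. -/
def IsMinimalCode (r : ℕ) (w : Certificate) (k : ℕ) : Prop :=
  (∃ e < w.1, IsOddAt r w.2.1 k e) ∧ ∀ l < 2 ^ r, (∃ e < w.1, IsOddAt r w.2.1 l e) →
    (∀ e < w.1, IsOddAt r w.2.1 l e → IsOddAt r w.2.1 k e) →
      ∀ e < w.1, IsOddAt r w.2.1 k e → IsOddAt r w.2.1 l e

open Classical in
/-- The classes modulo `2` of the elementary vectors. -/
noncomputable def minimalCodes (r : ℕ) (w : Certificate) : List ℕ :=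
  (List.range (2 ^ r)).filter (IsMinimalCode r w)

open Classical in
/-- The support modulo `2` of the class `k`, as a row of a `(0,1)`-matrix. -/
noncomputable def oddRow (r : ℕ) (w : Certificate) (k : ℕ) : List Bool :=
  (List.range w.1).map fun e => decide (IsOddAt r w.2.1 k e)

open Classical in
/-- The search for a certificate, which puts out the minimal supports modulo `2`. -/
noncomputable def reconstruct (A : List (List ℤ)) : Part (List (List Bool)) :=
  Nat.rfindOpt fun n => (Encodable.decode (α := Certificate) n).bind fun w =>
    if IsCertificate A w then some ((minimalCodes A.length w).map (oddRow A.length w)) else none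

variable {α : Type*} [Primcodable α] {r k l e : α → ℕ} {M : α → List (List ℤ)} {w : α → Certificate}

lemma primrec_combination {c : α → ℕ → ℤ} (hM : Primrec M) (hr : Primrec r) (hc : Primrec₂ c)
    (he : Primrec e) : Primrec fun a => combination (M a) (r a) (c a) (e a) :=
  primrec_sum_range hr (primrec_intMul.comp hc
    (primrec_entry (hM.comp .fst) .snd (he.comp .fst)))

lemma primrec_intCast_bit (hk : Primrec k) : Primrec₂ fun a i => (bit (k a) i : ℤ) :=
  (primrec_intSub_natCast.comp (primrec_bit.comp (hk.comp .fst) .snd) (.const 0)).of_eq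
    fun _ => sub_zero _

lemma primrecRel_isOddAt (hr : Primrec r) (hw : Primrec w) (hk : Primrec k) :
    PrimrecRel fun a e => IsOddAt (r a) (w a).2.1 (k a) e := by
  have hM : Primrec fun q : α × ℕ => (w q.1).2.1 := .comp .fst (.comp .snd (hw.comp .fst))
  exact primrecPred_odd.comp
    (primrec_combination hM (hr.comp .fst) (primrec_intCast_bit (hk.comp .fst)) .snd)

lemma primrecPred_isCertificate {A : α → List (List ℤ)} (hA : Primrec A) (hw : Primrec w) :
    PrimrecPred fun a => IsCertificate (A a) (w a) := by
  have hr := Primrec.list_length.comp hA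
  have hm := Primrec.fst.comp hw
  have hM := Primrec.fst.comp (Primrec.snd.comp hw)
  have hT := Primrec.snd.comp (Primrec.snd.comp hw)
  have hgram : PrimrecPred fun a => ∀ i < (A a).length, ∀ j < (A a).length, entry (A a) i j =
      ∑ e ∈ Finset.range (w a).1, entry (w a).2.1 i e * entry (w a).2.1 j e := by
    refine primrecPred_forall_lt hr (primrecPred_forall_lt (hr.comp .fst) (Primrec.eq.comp
      (primrec_entry (hA.comp (.comp .fst .fst)) (.comp .snd .fst) .snd)
      (primrec_sum_range (hm.comp (.comp .fst .fst)) (primrec_intMul.comp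
        (primrec_entry (hM.comp ?_) ?_ .snd) (primrec_entry (hM.comp ?_) ?_ .snd)))))
    exacts [.comp .fst (.comp .fst .fst), .comp .snd (.comp .fst .fst),
      .comp .fst (.comp .fst .fst), .comp .snd .fst]
  have hne : PrimrecPred fun a => ∀ e < (w a).1, ∃ i < (A a).length, entry (w a).2.1 i e ≠ 0 :=
    primrecPred_forall_lt hm (primrecPred_exists_lt (hr.comp .fst) (Primrec.eq.comp
      (primrec_entry (hM.comp (.comp .fst .fst)) .snd (.comp .snd .fst)) (.const 0)).not)
  have hsign : PrimrecPred fun a => ∀ k < 2 ^ (A a).length, ∀ e < (w a).1,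
      (combination (w a).2.1 (A a).length
        (fun i => bit k i + 2 * entry (w a).2.2 k i) e).natAbs ≤ 1 := by
    refine primrecPred_forall_lt (primrec_two_pow hr) (primrecPred_forall_lt (hm.comp .fst)
      (Primrec.nat_le.comp (primrec_natAbs.comp (primrec_combination (hM.comp (.comp .fst .fst))
        (hr.comp (.comp .fst .fst)) (primrec_intAdd.comp
          (primrec_intCast_bit (.comp .snd .fst)) (primrec_intMul.comp (.const 2)
            (primrec_entry (hT.comp ?_) ?_ .snd))) .snd)) (.const 1)))
    exacts [.comp .fst (.comp .fst .fst), .comp .snd (.comp .fst .fst)]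
  exact (hgram.and (hne.and hsign)).of_eq fun a =>
    ⟨fun ⟨h, h', h''⟩ => ⟨h, h', h''⟩, fun ⟨h, h', h''⟩ => ⟨h, h', h''⟩⟩

lemma primrecPred_exists_isOddAt (hr : Primrec r) (hw : Primrec w) (hk : Primrec k) :
    PrimrecPred fun a => ∃ e < (w a).1, IsOddAt (r a) (w a).2.1 (k a) e :=
  primrecPred_exists_lt (Primrec.fst.comp hw) (primrecRel_isOddAt hr hw hk)

lemma primrecPred_isOddAt_imp (hr : Primrec r) (hw : Primrec w) (hk : Primrec k)
    (hl : Primrec l) : PrimrecPred fun a => ∀ e < (w a).1,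
      IsOddAt (r a) (w a).2.1 (k a) e → IsOddAt (r a) (w a).2.1 (l a) e :=
  primrecPred_forall_lt (Primrec.fst.comp hw)
    (primrecPred_imp (primrecRel_isOddAt hr hw hk) (primrecRel_isOddAt hr hw hl))

lemma primrecPred_isMinimalCode (hr : Primrec r) (hw : Primrec w) (hk : Primrec k) :
    PrimrecPred fun a => IsMinimalCode (r a) (w a) (k a) := by
  have hr' : Primrec fun q : α × ℕ => r q.1 := hr.comp .fst
  have hw' : Primrec fun q : α × ℕ => w q.1 := hw.comp .fst
  have hk' : Primrec fun q : α × ℕ => k q.1 := hk.comp .fst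
  have hmin : PrimrecRel fun a l => (∃ e < (w a).1, IsOddAt (r a) (w a).2.1 l e) →
      (∀ e < (w a).1, IsOddAt (r a) (w a).2.1 l e → IsOddAt (r a) (w a).2.1 (k a) e) →
        ∀ e < (w a).1, IsOddAt (r a) (w a).2.1 (k a) e → IsOddAt (r a) (w a).2.1 l e :=
    primrecPred_imp (primrecPred_exists_isOddAt hr' hw' .snd)
      (primrecPred_imp (primrecPred_isOddAt_imp hr' hw' .snd hk')
        (primrecPred_isOddAt_imp hr' hw' hk' .snd))
  exact (primrecPred_exists_isOddAt hr hw hk).and (primrecPred_forall_lt (primrec_two_pow hr) hmin)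

lemma primrec_minimalCodes : Primrec₂ minimalCodes := by
  classical
  have h : PrimrecRel fun (k : ℕ) (p : ℕ × Certificate) => IsMinimalCode p.1 p.2 k :=
    primrecPred_isMinimalCode (.comp .fst .snd) (.comp .snd .snd) .fst
  exact h.listFilter.comp (Primrec.list_range.comp (primrec_two_pow .fst)) .id

lemma primrec_oddRow (hr : Primrec r) (hw : Primrec w) (hk : Primrec k) :
    Primrec fun a => oddRow (r a) (w a) (k a) := by
  classical
  exact Primrec.list_map (Primrec.list_range.comp (Primrec.fst.comp hw))
    (primrecRel_isOddAt hr hw hk).decide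

theorem partrec_reconstruct : Partrec (reconstruct : List (List ℤ) →. List (List Bool)) := by
  classical
  have hr : Primrec fun p : (List (List ℤ) × ℕ) × Certificate => p.1.1.length :=
    Primrec.list_length.comp (.comp .fst .fst)
  exact Partrec.rfindOpt (Primrec.to_comp (Primrec.option_bind (Primrec.decode.comp .snd)
    (Primrec.ite (primrecPred_isCertificate (.comp .fst .fst) .snd)
      (Primrec.option_some.comp (Primrec.list_map (primrec_minimalCodes.comp hr .snd)
        (primrec_oddRow (hr.comp .fst) (.comp .snd .fst) .snd))) (.const none))))

lemma exists_of_mem_reconstruct {A : List (List ℤ)} {X : List (List Bool)}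
    (hX : X ∈ reconstruct A) : ∃ w, IsCertificate A w ∧
      X = (minimalCodes A.length w).map (oddRow A.length w) := by
  obtain ⟨n, hn⟩ := Nat.rfindOpt_spec hX
  simp only [Option.mem_def, Option.bind_eq_some_iff] at hn
  obtain ⟨w, -, hw⟩ := hn
  split_ifs at hw with h
  exact ⟨w, h, (Option.some.inj hw).symm⟩

lemma IsCertificate.exists_mem_reconstruct {A : List (List ℤ)} {w : Certificate}
    (hw : IsCertificate A w) : ∃ X, X ∈ reconstruct A := by
  apply Part.dom_iff_mem.mp
  rw [reconstruct, Nat.rfindOpt_dom]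
  exact ⟨Encodable.encode w, (minimalCodes A.length w).map (oddRow A.length w), by
    simp only [Encodable.encodek, Option.bind_some, if_pos hw, Option.mem_def]⟩

end Search

section Certificates

variable {E : Type*} {r : ℕ} {B : Matrix (Fin r) E ℤ} {w : Certificate}

/-- The rows of a matrix as a list. -/
def matrixList {m n : ℕ} (F : Matrix (Fin m) (Fin n) ℤ) : List (List ℤ) :=
  List.ofFn fun i => List.ofFn (F i)

lemma entry_matrixList {m n : ℕ} (F : Matrix (Fin m) (Fin n) ℤ) (i : Fin m) (j : Fin n) :
    entry (matrixList F) i j = F i j := by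
  simp [entry, matrixList, List.getD_eq_getElem?_getD]

lemma length_matrixList {m n : ℕ} (F : Matrix (Fin m) (Fin n) ℤ) : (matrixList F).length = m :=
  List.length_ofFn

/-- The matrix listed by a certificate. -/
def certificateMatrix (r : ℕ) (w : Certificate) : Matrix (Fin r) (Fin w.1) ℤ :=
  fun i e => entry w.2.1 i e

lemma combination_eq_vecMul (c : ℕ → ℤ) (e : Fin w.1) :
    combination w.2.1 r c e = ((fun i : Fin r => c i) ᵥ* certificateMatrix r w) e :=
  Finset.sum_range _

/-- The lattice vector with coefficients the binary digits of `k`. -/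
def bitVec (r k : ℕ) : Fin r → ℤ := fun i => bit k i

lemma isOddAt_iff {k : ℕ} {e : Fin w.1} :
    IsOddAt r w.2.1 k e ↔ e ∈ oddSupport (certificateMatrix r w) (bitVec r k) := by
  rw [IsOddAt, combination_eq_vecMul]
  rfl

lemma exists_eq_bitVec_add (v : Fin r → ℤ) : ∃ k < 2 ^ r, ∃ y, v = bitVec r k + 2 • y := by
  let d : Fin r → Fin 2 := fun i => ⟨(v i % 2).toNat, by omega⟩
  refine ⟨finFunctionFinEquiv d, Fin.is_lt _, fun i => v i / 2, funext fun i => ?_⟩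
  have hbit : bit (finFunctionFinEquiv d : Fin (2 ^ r)) i = (v i % 2).toNat :=
    congrArg Fin.val (congrFun (finFunctionFinEquiv.symm_apply_apply d) i)
  rw [Pi.add_apply, Pi.smul_apply, bitVec, hbit, two_nsmul]
  omega

lemma eq_of_bitVec_eq_add {k l : ℕ} (hk : k < 2 ^ r) (hl : l < 2 ^ r) {y : Fin r → ℤ}
    (hkl : bitVec r k = bitVec r l + 2 • y) : k = l := by
  suffices hbit : ∀ i : Fin r, bit k i = bit l i by
    have : (finFunctionFinEquiv.symm ⟨k, hk⟩ : Fin r → Fin 2) = finFunctionFinEquiv.symm ⟨l, hl⟩ :=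
      funext fun i => Fin.ext (hbit i)
    exact congrArg Fin.val (finFunctionFinEquiv.symm.injective this)
  intro i
  have hi : (bit k i : ℤ) = bit l i + (y i + y i) := by
    rw [← two_nsmul]
    exact congrFun hkl i
  have hk2 : bit k i < 2 := Nat.mod_lt _ two_pos
  have hl2 : bit l i < 2 := Nat.mod_lt _ two_pos
  omega

lemma isCertificate_matrixList_iff (F : Matrix (Fin r) (Fin r) ℤ) :
    IsCertificate (matrixList F) w ↔
      F = certificateMatrix r w * (certificateMatrix r w)ᵀ ∧
      (∀ e, ∃ i, certificateMatrix r w i e ≠ 0) ∧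
      ∀ k < 2 ^ r, IsSignVector (certificateMatrix r w)
        (bitVec r k + 2 • fun i : Fin r => entry w.2.2 k i) := by
  have hgram (i j : Fin r) : ∑ e ∈ Finset.range w.1, entry w.2.1 i e * entry w.2.1 j e =
      (certificateMatrix r w * (certificateMatrix r w)ᵀ) i j := Finset.sum_range _
  have hsign (k : ℕ) (e : Fin w.1) :
      combination w.2.1 r (fun i => bit k i + 2 * entry w.2.2 k i) e =
        ((bitVec r k + 2 • fun i : Fin r => entry w.2.2 k i) ᵥ* certificateMatrix r w) e := by
    rw [combination_eq_vecMul]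
    rfl
  have hA : (matrixList F).length = r := length_matrixList F
  constructor
  · rintro ⟨h₁, h₂, h₃⟩
    rw [hA] at h₁ h₂ h₃
    refine ⟨Matrix.ext fun i j => ?_, fun e => ?_, fun k hk e => ?_⟩
    · rw [← hgram, ← h₁ i i.2 j j.2, entry_matrixList]
    · obtain ⟨i, hi, hie⟩ := h₂ e e.2
      exact ⟨⟨i, hi⟩, hie⟩
    · rw [← hsign, Int.abs_eq_natAbs]
      exact_mod_cast h₃ k hk e e.2
  · rintro ⟨h₁, h₂, h₃⟩
    constructor <;> rw [hA]
    · intro i hi j hj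
      rw [hgram ⟨i, hi⟩ ⟨j, hj⟩, ← h₁]
      exact entry_matrixList F ⟨i, hi⟩ ⟨j, hj⟩
    · intro e he
      obtain ⟨i, hi⟩ := h₂ ⟨e, he⟩
      exact ⟨i, i.2, hi⟩
    · intro k hk e he
      have hke := h₃ k hk ⟨e, he⟩
      rw [← hsign, Int.abs_eq_natAbs] at hke
      exact_mod_cast hke

lemma exists_isCertificate [Fintype E] (h : IsRegular B) :
    ∃ w, IsCertificate (matrixList (B * Bᵀ)) w := by
  choose t ht using h.hasSignRepresentatives
  let ε := (Fintype.equivFin E).symm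
  let w : Certificate := ⟨Fintype.card E, matrixList (B.submatrix id ε),
    matrixList (Matrix.of fun k : Fin (2 ^ r) => t (bitVec r k))⟩
  have hB : certificateMatrix r w = B.submatrix id ε :=
    Matrix.ext fun i e => entry_matrixList _ i e
  refine ⟨w, (isCertificate_matrixList_iff _).mpr ⟨?_, fun e => ?_, fun k hk e => ?_⟩⟩
  · rw [hB, Matrix.transpose_submatrix, Matrix.submatrix_mul_equiv, Matrix.submatrix_id_id]
  · rw [hB]
    exact h.col_ne (ε e)
  · have hentry : (fun i : Fin r => entry w.2.2 k i) = t (bitVec r k) :=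
      funext fun i => entry_matrixList _ (⟨k, hk⟩ : Fin (2 ^ r)) i
    rw [hentry, hB]
    exact ht _ (ε e)

namespace IsCertificate

lemma hasSignRepresentatives {F : Matrix (Fin r) (Fin r) ℤ}
    (hw : IsCertificate (matrixList F) w) : HasSignRepresentatives (certificateMatrix r w) := by
  intro v
  obtain ⟨k, hk, y, rfl⟩ := exists_eq_bitVec_add v
  refine ⟨(fun i : Fin r => entry w.2.2 k i) - y, ?_⟩
  convert ((isCertificate_matrixList_iff F).mp hw).2.2 k hk using 1
  rw [smul_sub, add_assoc, add_sub_cancel]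

lemma exists_equiv [Fintype E] (h : IsRegular B) (hw : IsCertificate (matrixList (B * Bᵀ)) w) :
    ∃ σ : Fin w.1 ≃ E, ∀ k (e : Fin w.1),
      IsOddAt r w.2.1 k e ↔ σ e ∈ oddSupport B (bitVec r k) := by
  obtain ⟨hgram, hcol, -⟩ := (isCertificate_matrixList_iff _).mp hw
  obtain ⟨σ, hσ⟩ := h.exists_equiv_of_gram_eq hw.hasSignRepresentatives hcol hgram
  refine ⟨σ, fun k e => ?_⟩
  have habs := hσ e (toReal (bitVec r k))
  rw [coord_toReal, coord_toReal, ← Int.cast_abs, ← Int.cast_abs, Int.cast_inj] at habs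
  rw [isOddAt_iff, oddSupport, oddSupport, Set.mem_ofPred_eq, Set.mem_ofPred_eq, ← odd_abs, ← habs,
    odd_abs]

end IsCertificate

section Codes

variable {σ : Fin w.1 ≃ E}
  (hσ : ∀ k (e : Fin w.1), IsOddAt r w.2.1 k e ↔ σ e ∈ oddSupport B (bitVec r k))

include hσ

lemma isMinimalCode_iff (k : ℕ) : IsMinimalCode r w k ↔
    Minimal (fun X => X.Nonempty ∧ X ∈ Set.range (oddSupport B)) (oddSupport B (bitVec r k)) := by
  have hne (k) : (∃ e < w.1, IsOddAt r w.2.1 k e) ↔ (oddSupport B (bitVec r k)).Nonempty := by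
    rw [Set.Nonempty, ← σ.exists_congr_right]
    simp only [← hσ, Fin.exists_iff, exists_prop]
  have hsub (k l) : (∀ e < w.1, IsOddAt r w.2.1 k e → IsOddAt r w.2.1 l e) ↔
      oddSupport B (bitVec r k) ⊆ oddSupport B (bitVec r l) := by
    rw [Set.subset_def, ← σ.forall_congr_right]
    simp only [← hσ, Fin.forall_iff]
  simp only [IsMinimalCode, hne, hsub]
  refine ⟨fun hk => ⟨⟨hk.1, _, rfl⟩, ?_⟩, fun hk => ⟨hk.prop.1, fun l _ hl => ?_⟩⟩
  · rintro _ ⟨hX, v, rfl⟩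
    obtain ⟨l, hl, y, rfl⟩ := exists_eq_bitVec_add v
    rw [oddSupport_add_two_smul] at hX ⊢
    exact hk.2 l hl hX
  · exact hk.2 ⟨hl, _, rfl⟩

open Classical in
lemma oddRow_eq (k : ℕ) :
    oddRow r w k = List.ofFn fun e => decide (σ e ∈ oddSupport B (bitVec r k)) := by
  refine List.ext_getElem (by simp [oddRow]) fun e he _ => ?_
  have he' : e < w.1 := by simpa [oddRow] using he
  simp [oddRow, hσ k ⟨e, he'⟩]

lemma mem_map_minimalCodes_iff [Finite E] (h : IsRegular B) (X : Set E) :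
    X ∈ (minimalCodes r w).map (fun k => oddSupport B (bitVec r k)) ↔
      ∃ v, IsElementary B v ∧ X = {e | (v ᵥ* B) e ≠ 0} := by
  rw [← h.minimal_oddSupport_iff]
  simp only [List.mem_map, minimalCodes, List.mem_filter, List.mem_range, decide_eq_true_eq,
    isMinimalCode_iff hσ]
  constructor
  · rintro ⟨k, ⟨-, hk⟩, rfl⟩
    exact hk
  · intro hX
    obtain ⟨v, rfl⟩ := hX.prop.2
    obtain ⟨k, hk, y, rfl⟩ := exists_eq_bitVec_add v
    rw [oddSupport_add_two_smul] at hX ⊢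
    exact ⟨k, ⟨hk, hX⟩, rfl⟩

omit hσ in
lemma nodup_map_minimalCodes [Finite E] (h : IsRegular B) :
    ((minimalCodes r w).map fun k => oddSupport B (bitVec r k)).Nodup := by
  refine List.Nodup.map_on (fun k hk l hl hkl => ?_) (List.nodup_range.filter _)
  obtain ⟨y, hy⟩ := h.exists_eq_add_two_smul hkl
  exact eq_of_bitVec_eq_add (List.mem_range.mp (List.mem_filter.mp hk).1)
    (List.mem_range.mp (List.mem_filter.mp hl).1) hy

end Codes

section MatroidMatrix

variable {α β : Type*} {G : Graph α β}

open Classical in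
lemma isMatroidMatrix_of_nodup {m : ℕ} (edge : Fin m ≃ E(G)) {L : List (Set E(G))}
    (hL : L.Nodup) (hC : ∀ X, X ∈ L ↔ IsCircuit G X) :
    IsMatroidMatrix G (L.map fun X => List.ofFn fun e => decide (edge e ∈ X)) := by
  let circuit := (hL.getEquiv L).trans (Equiv.subtypeEquivRight hC)
  exact ⟨m, edge, (finCongr (List.length_map _)).trans circuit, fun i => List.getElem_map _⟩

lemma IsCertificate.isMatroidMatrix [Fintype E(G)] {B : Matrix (Fin r) E(G) ℤ} (h : IsRegular B)
    (hC : ∀ X, IsCircuit G X ↔ ∃ v, IsElementary B v ∧ X = {e | (v ᵥ* B) e ≠ 0})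
    (hw : IsCertificate (matrixList (B * Bᵀ)) w) :
    IsMatroidMatrix G ((minimalCodes r w).map (oddRow r w)) := by
  obtain ⟨σ, hσ⟩ := hw.exists_equiv h
  have hX := isMatroidMatrix_of_nodup σ (nodup_map_minimalCodes (w := w) h)
    fun X => (mem_map_minimalCodes_iff hσ h X).trans (hC X).symm
  rw [List.map_map] at hX
  convert hX using 2
  exact funext (oddRow_eq hσ)

theorem exists_mem_reconstruct_isMatroidMatrix [Fintype E(G)] {o : Orientation G}
    {b : Module.Basis (Fin r) ℤ (flowLattice o)} (hG : TwoEdgeConnected G) :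
    ∃ X ∈ reconstruct (matrixList (gramMatrix b)), IsMatroidMatrix G X := by
  have h := isRegular_flowMatrix (b := b) hG
  rw [gramMatrix_eq]
  obtain ⟨w, hw⟩ := exists_isCertificate h
  obtain ⟨_, hX⟩ := hw.exists_mem_reconstruct
  obtain ⟨w', hw', rfl⟩ := exists_of_mem_reconstruct hX
  refine ⟨_, hX, ?_⟩
  rw [length_matrixList]
  refine hw'.isMatroidMatrix h fun X => (isCircuit_iff_exists_isElementary (b := b) hG X).trans ?_
  simp only [edgeSupport, flowOf_eq]

end MatroidMatrix

end Certificates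

section GroundSets

variable {E : Type*} {r : ℕ} [Fintype E] {B : Matrix (Fin r) E ℤ}

lemma IsRegular.classEdges_injective (h : IsRegular B) : Function.Injective h.classEdges := by
  intro c c' hcc'
  obtain ⟨e, he⟩ := h.classEdges_nonempty c
  exact h.eq_of_mem_classEdges he (hcc' ▸ he)

/-- The identification of the coordinates with the ground set put out by the procedure: within
each parallel class an arbitrary numbering is chosen. -/
noncomputable def IsRegular.groundSetEquiv (h : IsRegular B) :
    E ≃ GroundSet (B * Bᵀ) fun c => (h.classEdges c).ncard :=
  (Equiv.sigmaFiberEquiv h.classOf).symm.trans <| Equiv.sigmaCongrRight fun c =>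
    (Equiv.subtypeEquivRight fun e => (h.mem_classEdges_iff_classOf e c).symm).trans
      (Finite.equivFinOfCardEq rfl)

lemma IsRegular.mem_classEdges_iff_groundSetEquiv (h : IsRegular B) (e : E)
    (c : EdgeClass (B * Bᵀ)) : e ∈ h.classEdges c ↔ (h.groundSetEquiv e).1 = c :=
  h.mem_classEdges_iff_classOf e c

lemma IsRegular.not_participates_groundSetEquiv_iff (h : IsRegular B) {v : Fin r → ℤ}
    (hv : IsElementary B v) (e : E) :
    ¬ Participates (h.groundSetEquiv e).1 (bisectorFace (B * Bᵀ) v) ↔ (v ᵥ* B) e ≠ 0 :=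
  h.not_participates_iff hv.sign ((h.mem_classEdges_iff_groundSetEquiv e _).mpr rfl)

theorem IsRegular.isOutputCircuit_image_iff (h : IsRegular B) (X : Set E) :
    IsOutputCircuit (B * Bᵀ) (fun c => (h.classEdges c).ncard) (h.groundSetEquiv '' X) ↔
      ∃ v, IsElementary B v ∧ X = {e | (v ᵥ* B) e ≠ 0} := by
  have himage {v} (hv : IsElementary B v) :
      h.groundSetEquiv '' X = {p | ¬ Participates p.1 (bisectorFace (B * Bᵀ) v)} ↔
        X = {e | (v ᵥ* B) e ≠ 0} := by
    rw [Set.ext_iff, Set.ext_iff, ← h.groundSetEquiv.forall_congr_right]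
    refine forall_congr' fun e => ?_
    rw [h.groundSetEquiv.injective.mem_set_image, Set.mem_ofPred_eq,
      h.not_participates_groundSetEquiv_iff hv, Set.mem_ofPred_eq]
  constructor
  · rintro ⟨F, hF, hX⟩
    obtain ⟨v, hv, rfl⟩ := h.exists_isElementary_of_isFacet hF
    exact ⟨v, hv, (himage hv).mp hX⟩
  · rintro ⟨v, hv, hX⟩
    exact ⟨_, h.isFacet_of_isElementary hv, (himage hv).mpr hX⟩

end GroundSets

section FlowLattices

variable {α β : Type*} {G : Graph α β} [Fintype E(G)] {o : Orientation G} {r : ℕ}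
  {b : Module.Basis (Fin r) ℤ (flowLattice o)}

theorem isCancellationFree_of_isGoodBasis (hG : TwoEdgeConnected G) {C : Fin r → (Fin r → ℤ)}
    (hC : IsGoodBasis (flowMatrix b * (flowMatrix b)ᵀ) C) :
    IsCancellationFree o fun i => flowOf b (C i) := by
  have h := isRegular_flowMatrix (b := b) hG
  have hel := h.isElementary_of_isGoodBasis hC
  refine ⟨fun i => (isElementary_iff_isCircuitElement hG _).mp (hel i), fun i j => ?_⟩
  have hinter : edgeSupport (flowOf b (C i)) ∩ edgeSupport (flowOf b (C j)) =
      Finset.univ.filter fun e => (C i ᵥ* flowMatrix b) e * (C j ᵥ* flowMatrix b) e ≠ 0 := by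
    ext e
    simp [edgeSupport, flowOf_eq]
  beta_reduce
  rw [hinter, Set.ncard_coe_finset, Finset.natCast_card_filter, flowOf_eq, flowOf_eq, pairing,
    ← latticeForm_mul_transpose, h.abs_latticeForm_of_isGoodBasis hC]
  refine Finset.sum_congr rfl fun e _ => ?_
  rw [abs_eq_ite_of_abs_le_one ((hel i).sign.abs_mul_le_one (hel j).sign e), ite_not]

theorem range_classEdges_flowMatrix (hG : TwoEdgeConnected G) (h : IsRegular (flowMatrix b)) :
    Set.range h.classEdges = {S | IsTwoCutBlock G S} := by
  have hblock {c e} (he : e ∈ h.classEdges c) :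
      h.classEdges c = {f | e = f ∨ IsTwoCut G e f} := by
    ext f
    rw [h.mem_classEdges_iff he, parallelCoords_flowMatrix_iff hG, Set.mem_ofPred_eq]
  ext S
  constructor
  · rintro ⟨c, rfl⟩
    obtain ⟨e, he⟩ := h.classEdges_nonempty c
    exact ⟨e, hblock he⟩
  · rintro ⟨e, rfl⟩
    obtain ⟨c, he⟩ := h.exists_mem_classEdges e
    exact ⟨c, hblock he⟩

end FlowLattices

end FlowRecon

theorem theorem3 :
    ∃ compute : List (List ℤ) →. List (List Bool), Partrec compute ∧
    ∀ (α β : Type*) (G : Graph α β) [Fintype E(G)] (o : FlowRecon.Orientation G) (r : ℕ)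
      (b : Module.Basis (Fin r) ℤ (flowLattice o)), TwoEdgeConnected G →
    -- the matroid is computable from the Gram matrix
    (∃ X ∈ compute (List.ofFn fun i => List.ofFn (gramMatrix b i)), IsMatroidMatrix G X) ∧
    -- the list of facets, and its correspondence with the oriented circuits
    {F | IsFacet (gramMatrix b) F}.Finite ∧
    (∀ F, IsFacet (gramMatrix b) F → ∃! v, F = bisectorFace (gramMatrix b) v) ∧
    (∀ v, IsFacet (gramMatrix b) (bisectorFace (gramMatrix b) v) ↔
      IsCircuitElement o (flowOf b v)) ∧
    -- the choice of a good circuit basis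
    (∃ C, IsGoodBasis (gramMatrix b) C) ∧
    (∀ C, IsGoodBasis (gramMatrix b) C → IsCancellationFree o fun i => flowOf b (C i)) ∧
    -- the list of edges of the Voronoi cell; their parallel classes index the 2-cut blocks
    Finite (VoronoiEdge (gramMatrix b)) ∧
    ∃ S : EdgeClass (gramMatrix b) → Set E(G),
      Function.Injective S ∧ Set.range S = {B | IsTwoCutBlock G B} ∧
      -- for every choice of a good basis
      ∀ C, IsGoodBasis (gramMatrix b) C →
        -- the linear system has a unique positive integer solution,
        (∃! n, IsSolution (gramMatrix b) C n) ∧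
        ∀ n, IsSolution (gramMatrix b) C n →
          -- which gives the sizes of the 2-cut blocks,
          (∀ c, (S c).ncard = n c) ∧
          ∃ σ : E(G) ≃ GroundSet (gramMatrix b) n,
            -- the edge set is the disjoint union of the blocks,
            (∀ e c, e ∈ S c ↔ (σ e).1 = c) ∧
            -- an edge is in a circuit iff its class does not participate in the facet,
            (∀ v, IsCircuitElement o (flowOf b v) → ∀ e, e ∈ edgeSupport (flowOf b v) ↔
              ¬ Participates (σ e).1 (bisectorFace (gramMatrix b) v)) ∧
            -- and the output is the graphic matroid of the graph
            ∀ X : Set E(G), IsCircuit G X ↔ IsOutputCircuit (gramMatrix b) n (σ '' X) := by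
  refine ⟨reconstruct, partrec_reconstruct, fun α β G _ o r b hG =>
    ⟨exists_mem_reconstruct_isMatroidMatrix hG, ?_⟩⟩
  rw [gramMatrix_eq]
  have h := isRegular_flowMatrix (b := b) hG
  have hcirc := isElementary_iff_isCircuitElement (b := b) hG
  refine ⟨h.finite_isFace.subset fun F hF => hF.1, fun F => h.existsUnique_of_isFacet,
    fun v => (h.isFacet_bisectorFace_iff v).trans (hcirc v), h.exists_isGoodBasis,
    fun C => isCancellationFree_of_isGoodBasis hG, h.finite_voronoiEdge,
    h.classEdges, h.classEdges_injective, range_classEdges_flowMatrix hG h, fun C hC => ?_⟩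
  have hsol := h.isSolution_ncard hC
  refine ⟨⟨_, hsol, fun n hn => h.isSolution_unique hC hn hsol⟩, fun n hn => ?_⟩
  obtain rfl := h.isSolution_unique hC hn hsol
  refine ⟨fun c => rfl, h.groundSetEquiv, h.mem_classEdges_iff_groundSetEquiv,
    fun v hv e => ?_, fun X => ?_⟩
  · rw [h.not_participates_groundSetEquiv_iff ((hcirc v).mpr hv), flowOf_eq]
    rfl
  · rw [h.isOutputCircuit_image_iff, isCircuit_iff_exists_isElementary (b := b) hG]
    simp only [flowOf_eq, edgeSupport]
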